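/- **Setting.** Let $d\ge 2$, $0<q_{\min}\le q_{\max}$, $Q=[q_{\min},q_{\max}]$, let $\nu$ be a probability measure on $Q$ (the charge distribution) with mean $\langle q\rangle=\int q\,d\nu(q)$, and let $g:Q\to(0,\infty)$. Let $V:\mathbb{R}^d\to\mathbb{R}$ be continuous with $V(x)\to+\infty$ as $|x|\to\infty$ and $\int e^{-V(x)}dx<\infty$. Let $W:\mathbb{R}^d\times\mathbb{R}^d\to(-\infty,+\infty]$ be continuous and symmetric, finite off the diagonal and $+\infty$ on the diagonal, and such that for every compact $K$ the function $z\mapsto\sup\{W(x,y): x,y\in K,\ |x-y|\ge|z|\}$ is locally Lebesgue-integrable (an empty supremum counts as $0$). Assume that there are $c\in\mathbb{R}$ and $\varepsilon_0>0$ with $2\varepsilon_0\langle q\rangle<g(q)$ for all $q\in Q$ and $W(x,y)\ge c-\varepsilon_0(V(x)+V(y))$ for all $x,y$. For a probability measure $\mu$ on $Q\times\mathbb{R}^d$ put $$h(\mu)=\int q\,g(q)V(x)\,d\mu(q,x)+\iint qq'\,W(x,x')\,d\mu(q,x)\,d\mu(q',x')$$ (with $h(\mu)=+\infty$ if the first integral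 is infinite). Let $\mathcal{M}_\nu$ be the set of such $\mu$ with charge marginal $\nu$, and let the rate function be $\mathcal{I}_\nu=h-\inf_{\mathcal{M}_\nu}h$ on $\mathcal{M}_\nu$. Given $\mu$, write $U_\mu(x)=\int q'W(x,x')\,d\mu(q',x')$, and say that *forces are defined* at $x$ if $V$ is differentiable at $x$ with $\nabla V(x)\ne0$, and the integral $U_\mu$ converges absolutely at all points near $x$ and is differentiable at $x$. **Proposition.** 1. Let $\mu$ be a minimizer of $\mathcal{I}_\nu$ on $\mathcal{M}_\nu$, and let $(q,x),(q',x')\in\operatorname{supp}\mu$ with $q<q'$. If $g$ is strictly increasing, then $V(x')\le V(x)$, with strict inequality if forces are defined at $x$ and at $x'$ (so that at such a location, and on each level set of $V$ among such locations, there is only one charge). If $g$ is strictly decreasing, then $V(x)\le V(x')$, again strictly if forces are defined at $x$ and at $x'$. If moreover $V$ increases strictly with $|x|$ (that is, $|x|<|y|$ implies $V(x)<V(y)$), the same inequalities hold with $|x|,|x'|$ in place of $V(x),V(x')$: larger charges lie closer to the origin if $g$ is increasing, and farther from it if $g$ is decreasing. 2. Let $g$ be constant. Then the homogeneous gas in which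 every particle has charge $\langle q\rangle$ (that is, the case $\nu=\delta_{\langle q\rangle}$, with the same $V,W,g$) has an equilibrium (energy-minimizing) particle distribution $\rho$ on $\mathbb{R}^d$; for every such $\rho$ the disordered distribution $\nu\otimes\rho$ minimizes $\mathcal{I}_\nu$ on $\mathcal{M}_\nu$; and if $\nu$ is not a Dirac mass, then $\mathcal{I}_\nu$ has infinitely many minimizers on $\mathcal{M}_\nu$. -/

import Mathlib

open MeasureTheory Filter Topology

namespace HeteroGas

noncomputable section

/-- The physical space `ℝ^d` with its Euclidean norm. -/
abbrev Space (d : ℕ) : Type := EuclideanSpace ℝ (Fin d)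

/-- Integral of an extended-real function: integral of the positive part minus that of the
negative part (meaningful as soon as one of the two is finite). -/
def extIntegral {α : Type*} [MeasurableSpace α] (f : α → EReal) (μ : Measure α) : EReal :=
  ((∫⁻ a, (f a).toENNReal ∂μ : ENNReal) : EReal) -
    ((∫⁻ a, (-f a).toENNReal ∂μ : ENNReal) : EReal)

/-- Interaction kernel `W : ℝ^d × ℝ^d → (-∞, +∞]`, with the sign for which `+ q q' W(x, x')` is the
interaction energy. In `locInt` an empty supremum counts as `0`. -/
structure IsInteraction {d : ℕ} (W : Space d → Space d → EReal) : Prop where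
  cont : Continuous fun p : Space d × Space d => W p.1 p.2
  ne_bot : ∀ x y, W x y ≠ ⊥
  symm : ∀ x y, W x y = W y x
  finite_off_diag : ∀ x y, x ≠ y → W x y ≠ ⊤
  singular : ∀ x, W x x = ⊤
  locInt : ∀ K : Set (Space d), IsCompact K →
    LocallyIntegrable (fun z : Space d =>
      (sSup {w : EReal | ∃ x ∈ K, ∃ y ∈ K, ‖z‖ ≤ ‖x - y‖ ∧ w = W x y}).toReal) volume

/-- Confining potential. -/
structure IsConfining {d : ℕ} (V : Space d → ℝ) : Prop where
  cont : Continuous V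
  tendsto : Tendsto V (cocompact (Space d)) atTop
  integrable_exp : Integrable (fun x => Real.exp (-V x)) volume

/-- The mean charge `⟨q⟩`. -/
def meanCharge (ν : Measure ℝ) : ℝ := ∫ q, q ∂ν

/-- The confinement dominates the (possibly negative) interaction at infinity: the constant `ε₀`
is measured in the units in which the energy of a gas of mean charge `⟨q⟩` is coercive. -/
def Dominates {d : ℕ} (Q : Set ℝ) (ν : Measure ℝ) (g : ℝ → ℝ) (V : Space d → ℝ)
    (W : Space d → Space d → EReal) : Prop :=
  ∃ c ε₀ : ℝ, 0 < ε₀ ∧ (∀ q ∈ Q, 2 * ε₀ * meanCharge ν < g q) ∧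
    ∀ x y, ((c - ε₀ * (V x + V y) : ℝ) : EReal) ≤ W x y

open Classical in
/-- The intensive energy
`h(μ) = ∫ q g(q) V(x) dμ(q,x) + ∬ q q' W(x,x') dμ(q,x) dμ(q',x')`, with value `+∞` when the
confinement energy is infinite. -/
def energy {d : ℕ} (g : ℝ → ℝ) (V : Space d → ℝ) (W : Space d → Space d → EReal)
    (μ : Measure (ℝ × Space d)) : EReal :=
  if Integrable (fun p : ℝ × Space d => p.1 * g p.1 * V p.2) μ then
    ((∫ p, p.1 * g p.1 * V p.2 ∂μ : ℝ) : EReal) +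
      extIntegral (fun z : (ℝ × Space d) × (ℝ × Space d) =>
        ((z.1.1 * z.2.1 : ℝ) : EReal) * W z.1.2 z.2.2) (μ.prod μ)
  else ⊤

/-- `M_ν`: the probability measures on (charge, position) space with charge marginal `ν`. -/
def withCharge (d : ℕ) (ν : Measure ℝ) : Set (Measure (ℝ × Space d)) :=
  {μ | IsProbabilityMeasure μ ∧ μ.map Prod.fst = ν}

/-- The rate function `I_ν = h - K_ν`, where `K_ν` is the infimum of `h` over `M_ν`. -/
def rateFunction {d : ℕ} (g : ℝ → ℝ) (V : Space d → ℝ) (W : Space d → Space d → EReal)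
    (ν : Measure ℝ) (μ : Measure (ℝ × Space d)) : EReal :=
  energy g V W μ - ⨅ μ' ∈ withCharge d ν, energy g V W μ'

/-- `μ` is a minimizer of the rate function on `M_ν`. -/
def IsEquilibrium {d : ℕ} (g : ℝ → ℝ) (V : Space d → ℝ) (W : Space d → Space d → EReal)
    (ν : Measure ℝ) (μ : Measure (ℝ × Space d)) : Prop :=
  μ ∈ withCharge d ν ∧ IsMinOn (rateFunction g V W ν) (withCharge d ν) μ

/-- `ρ` is an equilibrium particle distribution of the homogeneous gas in which every particle
has charge `a`. -/
def IsHomogeneousEquilibrium {d : ℕ} (g : ℝ → ℝ) (V : Space d → ℝ)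
    (W : Space d → Space d → EReal) (a : ℝ) (ρ : Measure (Space d)) : Prop :=
  IsProbabilityMeasure ρ ∧
    IsEquilibrium g V W (Measure.dirac a) ((Measure.dirac a).prod ρ)

/-- The potential `x ↦ ∫ q' W(x, x') dμ(q', x')` created by the charges of `μ`. -/
def chargePotential {d : ℕ} (W : Space d → Space d → EReal) (μ : Measure (ℝ × Space d))
    (x : Space d) : ℝ :=
  ∫ p, p.1 * (W x p.2).toReal ∂μ

/-- The forces on a particle at `x` are defined and the confinement pulls on it: `∇V(x)` exists
and is nonzero, and the potential of the charges is finite near `x` and differentiable at `x`. -/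
structure HasForces {d : ℕ} (V : Space d → ℝ) (W : Space d → Space d → EReal)
    (μ : Measure (ℝ × Space d)) (x : Space d) : Prop where
  diff_conf : DifferentiableAt ℝ V x
  grad_ne_zero : fderiv ℝ V x ≠ 0
  integrable_near : ∀ᶠ y in 𝓝 x,
    Integrable (fun p : ℝ × Space d => p.1 * (W y p.2).toReal) μ
  diff_pot : DifferentiableAt ℝ (chargePotential W μ) x

/-- Larger charges sit at lower levels of `f`; strictly lower where the forces are defined. -/
def LargerChargesInside {d : ℕ} (V : Space d → ℝ) (W : Space d → Space d → EReal)
    (μ : Measure (ℝ × Space d)) (f : Space d → ℝ) : Prop :=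
  ∀ q x q' x', (q, x) ∈ μ.support → (q', x') ∈ μ.support → q < q' →
    f x' ≤ f x ∧ (HasForces V W μ x → HasForces V W μ x' → f x' < f x)

/-- Larger charges sit at higher levels of `f`; strictly higher where the forces are defined. -/
def LargerChargesOutside {d : ℕ} (V : Space d → ℝ) (W : Space d → Space d → EReal)
    (μ : Measure (ℝ × Space d)) (f : Space d → ℝ) : Prop :=
  ∀ q x q' x', (q, x) ∈ μ.support → (q', x') ∈ μ.support → q < q' →
    f x ≤ f x' ∧ (HasForces V W μ x → HasForces V W μ x' → f x < f x')

/-- `V` increases strictly with the distance to the origin. -/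
def RadiallyIncreasing {d : ℕ} (V : Space d → ℝ) : Prop :=
  ∀ x y, ‖x‖ < ‖y‖ → V x < V y

end

end HeteroGas

/-! The interaction sees a particle distribution $\mu$ only through its charge density $\sigma$, the
image in space of $q\,d\mu$, whereas the confinement also sees which charge sits where. Everything
follows from varying $\mu$ at fixed charge marginal, either keeping $\sigma$ fixed or moving it
slightly.

Signs and infinities are removed beforehand. Write $a=\langle q\rangle$. Integrating the lower bound
$c-\varepsilon(V(x)+V(y))$ against $\sigma\otimes\sigma$ gives $a^2c-2\varepsilon a\int V\,d\sigma$.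
The last term is absorbed by the strength, since $G=g-2\varepsilon a$ is still positive. With
$m=\min V$, the energy on $\mathcal M_\nu$ is therefore a real constant plus a functional with
nonnegative strength $G$, potential $v=V-m$ and kernel $k=W-c+\varepsilon(V+V)$
(`energy_eq_reducedEnergy`, `Reduction.isEquilibrium_iff`).

Weak ordering is a rearrangement inequality. Two groups of particles with equal total charge can
exchange positions without changing $\sigma$ or the charge marginal. If one group had both larger
$G$ and larger $v$ than the other, the exchange would lower the energy (`IsReducedMin.not_ordered`).

Strict ordering uses the Euler-Lagrange condition. Near a point $(q,x)$ of the support some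
effective strength $\gamma$, an average or limit of averages of values of $G$ near $q$, makes
$\gamma v+2u$ minimal at $x$, where $u$ is the potential of $\sigma$ for $k$
(`IsReducedMin.exists_effective_strength`). Here minimality means that every nonempty open set
contains a point with at least this value. If two particles with separated strengths
$\gamma<\gamma'$ had $V(x)=V(x')$, comparing the two conditions would give $u(x)=u(x')$. Both
$\gamma v+2u$ and $\gamma' v+2u$ would then be stationary at $x'$, so $(\gamma'-\gamma)\nabla
V(x')=0$, contrary to $\nabla V(x')\ne0$.

When $g$ is constant the whole reduced energy depends on $\sigma$ alone, so the problem is that of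
the homogeneous gas. Its minimizer exists by lower semicontinuity and tightness, and
$\nu\otimes\rho$ has the same charge density. Multiplying $\nu\otimes\rho$ by $1+t f(q)b(x)$, with
$\int b\,d\rho=0$ and $\int qf\,d\nu=0$, preserves both the charge marginal and $\sigma$. This gives
a family of minimizers, injective in $t$ unless $\nu$ is a Dirac mass. -/

namespace HeteroGas

open scoped ENNReal NNReal

noncomputable section

/-! ### Charge densities and energies for nonnegative kernels -/

section Abstract

variable {X : Type*} [MeasurableSpace X]

/-- The distribution of charge in space of a particle distribution. -/
def chargeDensity (μ : Measure (ℝ × X)) : Measure X :=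
  (μ.withDensity fun p => ENNReal.ofReal p.1).map Prod.snd

/-- Mutual energy of two charge distributions for a nonnegative kernel. -/
def mutualEnergy (k : X → X → ℝ≥0∞) (σ τ : Measure X) : ℝ≥0∞ :=
  ∫⁻ x, ∫⁻ y, k x y ∂τ ∂σ

/-- Confinement energy for a nonnegative potential and a charge-dependent strength. -/
def confinementEnergy (G : ℝ → ℝ≥0) (v : X → ℝ≥0) (μ : Measure (ℝ × X)) : ℝ≥0∞ :=
  ∫⁻ p, ENNReal.ofReal p.1 * G p.1 * v p.2 ∂μ

/-- Total energy for a nonnegative confinement and a nonnegative kernel. -/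
def reducedEnergy (G : ℝ → ℝ≥0) (v : X → ℝ≥0) (k : X → X → ℝ≥0∞) (μ : Measure (ℝ × X)) : ℝ≥0∞ :=
  confinementEnergy G v μ + mutualEnergy k (chargeDensity μ) (chargeDensity μ)

/-- Minimizers of the reduced energy among particle distributions with given charge marginal. -/
def IsReducedMin (G : ℝ → ℝ≥0) (v : X → ℝ≥0) (k : X → X → ℝ≥0∞) (μ : Measure (ℝ × X)) : Prop :=
  ∀ μ' : Measure (ℝ × X), μ'.map Prod.fst = μ.map Prod.fst →
    reducedEnergy G v k μ ≤ reducedEnergy G v k μ'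

lemma measurable_ofReal_fst : Measurable fun p : ℝ × X => ENNReal.ofReal p.1 := by fun_prop

lemma lintegral_chargeDensity (μ : Measure (ℝ × X)) {f : X → ℝ≥0∞} (hf : Measurable f) :
    ∫⁻ x, f x ∂chargeDensity μ = ∫⁻ p, ENNReal.ofReal p.1 * f p.2 ∂μ := by
  rw [chargeDensity, lintegral_map hf measurable_snd,
    lintegral_withDensity_eq_lintegral_mul _ measurable_ofReal_fst (by fun_prop)]
  rfl

lemma chargeDensity_add (μ μ' : Measure (ℝ × X)) :
    chargeDensity (μ + μ') = chargeDensity μ + chargeDensity μ' := by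
  rw [chargeDensity, withDensity_add_measure, Measure.map_add _ _ measurable_snd]
  rfl

lemma chargeDensity_smul (t : ℝ≥0∞) (μ : Measure (ℝ × X)) :
    chargeDensity (t • μ) = t • chargeDensity μ := by
  rw [chargeDensity, withDensity_smul_measure, Measure.map_smul]
  rfl

lemma chargeDensity_univ (μ : Measure (ℝ × X)) :
    chargeDensity μ Set.univ = ∫⁻ q, ENNReal.ofReal q ∂(μ.map Prod.fst) := by
  have := lintegral_chargeDensity μ (f := fun _ => 1) measurable_const
  simp only [lintegral_const, one_mul, mul_one] at this
  rw [this, lintegral_map (by fun_prop) measurable_fst]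

lemma chargeDensity_prod (ν : Measure ℝ) [SFinite ν] (ρ : Measure X) [SFinite ρ] :
    chargeDensity (ν.prod ρ) = (∫⁻ q, ENNReal.ofReal q ∂ν) • ρ := by
  ext s hs
  rw [← lintegral_indicator_one hs, lintegral_chargeDensity _ (measurable_one.indicator hs),
    lintegral_prod_mul (f := fun q => ENNReal.ofReal q) (g := s.indicator 1) (by fun_prop)
      (measurable_one.indicator hs).aemeasurable, lintegral_indicator_one hs]
  rfl

lemma chargeDensity_mono {μ μ' : Measure (ℝ × X)} (h : μ ≤ μ') :
    chargeDensity μ ≤ chargeDensity μ' := by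
  intro s
  refine Measure.map_mono ?_ measurable_snd s
  refine Measure.le_iff.2 (fun t ht => ?_)
  rw [withDensity_apply _ ht, withDensity_apply _ ht]
  exact lintegral_mono' (Measure.restrict_mono le_rfl h) le_rfl

lemma chargeDensity_restrict_ne_zero {μ : Measure (ℝ × X)} (hpos : ∀ᵐ p ∂μ, 0 < p.1)
    {A : Set (ℝ × X)} (hA0 : μ A ≠ 0) : chargeDensity (μ.restrict A) Set.univ ≠ 0 := by
  intro h0
  have h1 := lintegral_chargeDensity (μ.restrict A) (f := fun _ => 1) measurable_const
  simp only [lintegral_const, one_mul, mul_one, h0] at h1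
  rw [eq_comm, lintegral_eq_zero_iff (by fun_prop)] at h1
  have h2 : ∀ᵐ p ∂μ.restrict A, False := by
    filter_upwards [h1, ae_restrict_of_ae hpos] with p hp hp'
    simp only [Pi.zero_apply, ENNReal.ofReal_eq_zero] at hp
    exact hp.not_gt hp'
  rw [ae_iff] at h2
  simp only [not_false_eq_true, Set.ofPred_true, Measure.restrict_apply_univ] at h2
  exact hA0 h2

section Mutual

variable {k : X → X → ℝ≥0∞}

lemma mutualEnergy_add_left (σ σ' τ : Measure X) :
    mutualEnergy k (σ + σ') τ = mutualEnergy k σ τ + mutualEnergy k σ' τ :=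
  lintegral_add_measure _ _ _

lemma mutualEnergy_smul_left (t : ℝ≥0∞) (σ τ : Measure X) :
    mutualEnergy k (t • σ) τ = t * mutualEnergy k σ τ :=
  lintegral_smul_measure _ _

lemma mutualEnergy_mono {σ σ' τ τ' : Measure X} (h : σ ≤ σ') (h' : τ ≤ τ') :
    mutualEnergy k σ τ ≤ mutualEnergy k σ' τ' :=
  lintegral_mono' h fun _ => lintegral_mono' h' le_rfl

variable (hk : Measurable (Function.uncurry k))
include hk

lemma measurable_potential (τ : Measure X) [SFinite τ] : Measurable fun x => ∫⁻ y, k x y ∂τ :=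
  hk.lintegral_prod_right'

lemma mutualEnergy_comm (hs : ∀ x y, k x y = k y x) (σ τ : Measure X) [SFinite σ] [SFinite τ] :
    mutualEnergy k σ τ = mutualEnergy k τ σ := by
  rw [mutualEnergy, lintegral_lintegral_swap hk.aemeasurable]
  simp_rw [mutualEnergy, fun x y => hs y x]

lemma mutualEnergy_add_self (hs : ∀ x y, k x y = k y x) (σ τ : Measure X)
    [SFinite σ] [SFinite τ] :
    mutualEnergy k (σ + τ) (σ + τ) =
      mutualEnergy k σ σ + 2 * mutualEnergy k σ τ + mutualEnergy k τ τ := by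
  rw [mutualEnergy_add_left, mutualEnergy_comm hk hs σ (σ + τ), mutualEnergy_comm hk hs τ (σ + τ),
    mutualEnergy_add_left, mutualEnergy_add_left, mutualEnergy_comm hk hs τ σ]
  ring

lemma mutualEnergy_smul_right (hs : ∀ x y, k x y = k y x) (t : ℝ≥0∞) (σ τ : Measure X)
    [SFinite σ] [SFinite τ] :
    mutualEnergy k σ (t • τ) = t * mutualEnergy k σ τ := by
  rw [mutualEnergy_comm hk hs, mutualEnergy_smul_left, mutualEnergy_comm hk hs]

end Mutual

variable {G : ℝ → ℝ≥0} {v : X → ℝ≥0}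

lemma confinementEnergy_add (μ μ' : Measure (ℝ × X)) :
    confinementEnergy G v (μ + μ') = confinementEnergy G v μ + confinementEnergy G v μ' :=
  lintegral_add_measure _ _ _

lemma confinementEnergy_smul (t : ℝ≥0∞) (μ : Measure (ℝ × X)) :
    confinementEnergy G v (t • μ) = t * confinementEnergy G v μ :=
  lintegral_smul_measure _ _

lemma confinementEnergy_prod (hG : Measurable G) (hv : Measurable v) (ν : Measure ℝ)
    (ρ : Measure X) [SFinite ρ] :
    confinementEnergy G v (ν.prod ρ) =
      (∫⁻ q, ENNReal.ofReal q * G q ∂ν) * ∫⁻ x, v x ∂ρ :=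
  lintegral_prod_mul (f := fun q => ENNReal.ofReal q * G q) (g := fun x => (v x : ℝ≥0∞))
    (by fun_prop) (by fun_prop)

/-! ### Variational inequalities: exchange and first variation -/

variable {k : X → X → ℝ≥0∞}

/-- A minimizer also minimizes the confinement energy at fixed charge density. -/
lemma IsReducedMin.confinementEnergy_le {μ μ' : Measure (ℝ × X)} (h : IsReducedMin G v k μ)
    (hfin : reducedEnergy G v k μ ≠ ⊤) (h1 : μ'.map Prod.fst = μ.map Prod.fst)
    (h2 : chargeDensity μ' = chargeDensity μ) :
    confinementEnergy G v μ ≤ confinementEnergy G v μ' := by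
  have := h μ' h1
  rw [reducedEnergy, reducedEnergy, h2] at this
  exact (ENNReal.add_le_add_iff_right (ne_top_of_le_ne_top hfin le_add_self)).1 this

/-- Exchanging the positions of two groups of particles with equal charge does not change the charge
density. -/
lemma IsReducedMin.exchange (hG : Measurable G) (hv : Measurable v)
    {μ η α β : Measure (ℝ × X)} [IsFiniteMeasure α] [IsFiniteMeasure β]
    (h : IsReducedMin G v k μ)
    (hfin : reducedEnergy G v k μ ≠ ⊤) (hμ : η + (α + β) = μ) {S : ℝ≥0∞} (hS0 : S ≠ 0)
    (hS : S ≠ ⊤) (hα : chargeDensity α Set.univ = S) (hβ : chargeDensity β Set.univ = S)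
    (hη : confinementEnergy G v η ≠ ⊤) :
    S * (confinementEnergy G v α + confinementEnergy G v β) ≤
      (∫⁻ p, ENNReal.ofReal p.1 * G p.1 ∂α) * (∫⁻ p, ENNReal.ofReal p.1 * v p.2 ∂β) +
      (∫⁻ p, ENNReal.ofReal p.1 * G p.1 ∂β) * (∫⁻ p, ENNReal.ofReal p.1 * v p.2 ∂α) := by
  have : IsFiniteMeasure (chargeDensity α) := ⟨by rw [hα]; exact hS.lt_top⟩
  have : IsFiniteMeasure (chargeDensity β) := ⟨by rw [hβ]; exact hS.lt_top⟩
  have hSS : S⁻¹ * S = 1 := ENNReal.inv_mul_cancel hS0 hS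
  -- Each group keeps its charges and takes over the charge density of the other, independently of
  -- charge. The factor `S⁻¹` works for both constraints: the density of either group has mass `S`,
  -- and the total charge of either group is also `S`.
  set μ' : Measure (ℝ × X) := η + S⁻¹ • ((α.map Prod.fst).prod (chargeDensity β) +
    (β.map Prod.fst).prod (chargeDensity α)) with hμ'
  have h1 : μ'.map Prod.fst = μ.map Prod.fst := by
    rw [hμ', ← hμ, Measure.map_add _ _ measurable_fst, Measure.map_add _ _ measurable_fst,
      Measure.map_smul, Measure.map_add _ _ measurable_fst, Measure.map_add _ _ measurable_fst,
      Measure.map_fst_prod, Measure.map_fst_prod, hα, hβ, ← smul_add, smul_smul, hSS, one_smul]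
  have h2 : chargeDensity μ' = chargeDensity μ := by
    rw [hμ', ← hμ, chargeDensity_add, chargeDensity_add, chargeDensity_smul, chargeDensity_add,
      chargeDensity_add, chargeDensity_prod, chargeDensity_prod, ← chargeDensity_univ,
      ← chargeDensity_univ, hα, hβ, ← smul_add, smul_smul, hSS, one_smul, add_comm (chargeDensity β)]
  have key := h.confinementEnergy_le hfin h1 h2
  rw [hμ', ← hμ, confinementEnergy_add, confinementEnergy_add, confinementEnergy_add,
    confinementEnergy_smul, ENNReal.add_le_add_iff_left hη, confinementEnergy_add,
    confinementEnergy_prod hG hv, confinementEnergy_prod hG hv,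
    lintegral_map (by fun_prop) measurable_fst, lintegral_map (by fun_prop) measurable_fst,
    lintegral_chargeDensity _ (by fun_prop), lintegral_chargeDensity _ (by fun_prop)] at key
  calc _ ≤ S * _ := mul_le_mul_right key _
    _ = _ := by rw [← mul_assoc, ENNReal.mul_inv_cancel hS0 hS, one_mul]

/-- In a minimizer, two groups of particles never have strength and potential ordered the same
way. -/
theorem IsReducedMin.not_ordered (hG : Measurable G) (hv : Measurable v)
    {μ : Measure (ℝ × X)} [IsFiniteMeasure μ] (h : IsReducedMin G v k μ)
    (hfin : reducedEnergy G v k μ ≠ ⊤) (hpos : ∀ᵐ p ∂μ, 0 < p.1)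
    (hmass : chargeDensity μ Set.univ ≠ ⊤) {A B : Set (ℝ × X)} (hA : MeasurableSet A)
    (hB : MeasurableSet B) (hA0 : μ A ≠ 0) (hB0 : μ B ≠ 0)
    {gA vA : ℝ≥0} (hgA : ∀ p ∈ A, G p.1 ≤ gA) (hvA : ∀ p ∈ A, v p.2 ≤ vA)
    (hgB : ∀ p ∈ B, gA < G p.1) (hvB : ∀ p ∈ B, vA < v p.2) : False := by
  have hdisj : Disjoint A B := Set.disjoint_left.2 fun p hpA hpB =>
    ((hgA p hpA).trans_lt (hgB p hpB)).false
  have hmassr : ∀ C : Set (ℝ × X), chargeDensity (μ.restrict C) Set.univ ≠ ⊤ := fun C =>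
    ne_top_of_le_ne_top hmass (chargeDensity_mono Measure.restrict_le_self _)
  set a := chargeDensity (μ.restrict A) Set.univ with ha
  set b := chargeDensity (μ.restrict B) Set.univ with hb
  have ha0 := chargeDensity_restrict_ne_zero hpos hA0
  have hb0 := chargeDensity_restrict_ne_zero hpos hB0
  have haT := hmassr A
  have hbT := hmassr B
  set T := a + b with hT
  have hT0 : T ≠ 0 := by simp [hT, ha0, ha]
  have hTT : T ≠ ⊤ := ENNReal.add_ne_top.2 ⟨haT, hbT⟩
  have hs1 : b / T ≤ 1 := ENNReal.div_le_of_le_mul (by rw [one_mul]; exact le_add_self)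
  have ht1 : a / T ≤ 1 := ENNReal.div_le_of_le_mul (by rw [one_mul]; exact le_self_add)
  -- The groups `A` and `B` carry charges `a` and `b`. Keeping the fractions `b / (a + b)` and `a /
  -- (a + b)` gives both the charge `a * b / (a + b)`, and the fractions are at most one.
  set α := (b / T) • μ.restrict A with hαdef
  set β := (a / T) • μ.restrict B with hβdef
  have hαle : α ≤ μ.restrict A := by
    intro s; simpa [hαdef] using mul_le_mul_left hs1 (μ.restrict A s)
  have hβle : β ≤ μ.restrict B := by
    intro s; simpa [hβdef] using mul_le_mul_left ht1 (μ.restrict B s)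
  have hle : α + β ≤ μ := by
    refine (add_le_add hαle hβle).trans ?_
    rw [← Measure.restrict_union hdisj hB]
    exact Measure.restrict_le_self
  have : IsFiniteMeasure α := isFiniteMeasure_of_le _ hαle
  have : IsFiniteMeasure β := isFiniteMeasure_of_le _ hβle
  set S := a * b / T with hSdef
  have hS0 : S ≠ 0 := ENNReal.div_ne_zero.2 ⟨mul_ne_zero ha0 hb0, hTT⟩
  have hST : S ≠ ⊤ := ENNReal.div_ne_top (ENNReal.mul_ne_top haT hbT) hT0
  have hα : chargeDensity α Set.univ = S := by
    rw [hαdef, chargeDensity_smul, Measure.smul_apply, ← ha, smul_eq_mul, hSdef, mul_comm,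
      mul_div_assoc]
  have hβ : chargeDensity β Set.univ = S := by
    rw [hβdef, chargeDensity_smul, Measure.smul_apply, ← hb, smul_eq_mul, hSdef, mul_comm a b,
      mul_div_assoc, mul_comm]
  have hμ : μ - (α + β) + (α + β) = μ := Measure.sub_add_cancel_of_le hle
  have hconf : confinementEnergy G v μ ≠ ⊤ := ne_top_of_le_ne_top hfin le_self_add
  have hsplit : confinementEnergy G v (μ - (α + β)) +
      (confinementEnergy G v α + confinementEnergy G v β) ≠ ⊤ := by
    rw [← confinementEnergy_add, ← confinementEnergy_add, hμ]; exact hconf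
  have hη := ne_top_of_le_ne_top hsplit le_self_add
  have hLα := ne_top_of_le_ne_top (ne_top_of_le_ne_top hsplit le_add_self) le_self_add
  have hLβ := ne_top_of_le_ne_top (ne_top_of_le_ne_top hsplit le_add_self) le_add_self
  have key := h.exchange hG hv hfin hμ hS0 hST hα hβ hη
  have hSα : ∫⁻ p, ENNReal.ofReal p.1 ∂α = S := by
    rw [← hα, chargeDensity_univ, lintegral_map (by fun_prop) measurable_fst]
  have hSβ : ∫⁻ p, ENNReal.ofReal p.1 ∂β = S := by
    rw [← hβ, chargeDensity_univ, lintegral_map (by fun_prop) measurable_fst]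
  have haeα : ∀ᵐ p ∂α, p ∈ A ∧ 0 < p.1 := by
    refine ae_mono hαle ?_
    filter_upwards [ae_restrict_mem hA, ae_restrict_of_ae hpos] with p h1 h2 using ⟨h1, h2⟩
  have haeβ : ∀ᵐ p ∂β, p ∈ B ∧ 0 < p.1 := by
    refine ae_mono hβle ?_
    filter_upwards [ae_restrict_mem hB, ae_restrict_of_ae hpos] with p h1 h2 using ⟨h1, h2⟩
  have hLHS : S * (confinementEnergy G v α + confinementEnergy G v β) =
      ∫⁻ z, ENNReal.ofReal z.1.1 * ENNReal.ofReal z.2.1 *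
        ((G z.1.1 * v z.1.2 + G z.2.1 * v z.2.2 : ℝ≥0) : ℝ≥0∞) ∂α.prod β := by
    have e : ∀ z : (ℝ × X) × (ℝ × X), ENNReal.ofReal z.1.1 * ENNReal.ofReal z.2.1 *
        ((G z.1.1 * v z.1.2 + G z.2.1 * v z.2.2 : ℝ≥0) : ℝ≥0∞) =
        (ENNReal.ofReal z.1.1 * G z.1.1 * v z.1.2) * ENNReal.ofReal z.2.1 +
        ENNReal.ofReal z.1.1 * (ENNReal.ofReal z.2.1 * G z.2.1 * v z.2.2) := by
      intro z; push_cast; ring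
    simp_rw [e]
    rw [lintegral_add_left (by fun_prop),
      lintegral_prod_mul (f := fun p : ℝ × X => ENNReal.ofReal p.1 * G p.1 * v p.2)
        (g := fun p : ℝ × X => ENNReal.ofReal p.1) (by fun_prop) (by fun_prop),
      lintegral_prod_mul (f := fun p : ℝ × X => ENNReal.ofReal p.1)
        (g := fun p : ℝ × X => ENNReal.ofReal p.1 * G p.1 * v p.2) (by fun_prop) (by fun_prop),
      hSα, hSβ, mul_add, mul_comm S]
    rfl
  have hRHS : (∫⁻ p, ENNReal.ofReal p.1 * G p.1 ∂α) * (∫⁻ p, ENNReal.ofReal p.1 * v p.2 ∂β) +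
      (∫⁻ p, ENNReal.ofReal p.1 * G p.1 ∂β) * (∫⁻ p, ENNReal.ofReal p.1 * v p.2 ∂α) =
      ∫⁻ z, ENNReal.ofReal z.1.1 * ENNReal.ofReal z.2.1 *
        ((G z.1.1 * v z.2.2 + G z.2.1 * v z.1.2 : ℝ≥0) : ℝ≥0∞) ∂α.prod β := by
    have e : ∀ z : (ℝ × X) × (ℝ × X), ENNReal.ofReal z.1.1 * ENNReal.ofReal z.2.1 *
        ((G z.1.1 * v z.2.2 + G z.2.1 * v z.1.2 : ℝ≥0) : ℝ≥0∞) =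
        (ENNReal.ofReal z.1.1 * G z.1.1) * (ENNReal.ofReal z.2.1 * v z.2.2) +
        (ENNReal.ofReal z.1.1 * v z.1.2) * (ENNReal.ofReal z.2.1 * G z.2.1) := by
      intro z; push_cast; ring
    simp_rw [e]
    rw [lintegral_add_left (by fun_prop),
      lintegral_prod_mul (f := fun p : ℝ × X => ENNReal.ofReal p.1 * G p.1)
        (g := fun p : ℝ × X => ENNReal.ofReal p.1 * v p.2) (by fun_prop) (by fun_prop),
      lintegral_prod_mul (f := fun p : ℝ × X => ENNReal.ofReal p.1 * v p.2)
        (g := fun p : ℝ × X => ENNReal.ofReal p.1 * G p.1) (by fun_prop) (by fun_prop),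
      mul_comm (∫⁻ p, ENNReal.ofReal p.1 * G p.1 ∂β)]
  -- Two-point rearrangement: $(G_B-G_A)(v_B-v_A)>0$, so the aligned sum of products exceeds the
  -- crossed one.
  have hlt : ∀ᵐ z ∂α.prod β, ENNReal.ofReal z.1.1 * ENNReal.ofReal z.2.1 *
        ((G z.1.1 * v z.2.2 + G z.2.1 * v z.1.2 : ℝ≥0) : ℝ≥0∞) <
      ENNReal.ofReal z.1.1 * ENNReal.ofReal z.2.1 *
        ((G z.1.1 * v z.1.2 + G z.2.1 * v z.2.2 : ℝ≥0) : ℝ≥0∞) := by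
    filter_upwards [Measure.quasiMeasurePreserving_fst.ae haeα,
      Measure.quasiMeasurePreserving_snd.ae haeβ] with z hz1 hz2
    refine ENNReal.mul_lt_mul_right (mul_ne_zero ?_ ?_)
      (ENNReal.mul_ne_top ENNReal.ofReal_ne_top ENNReal.ofReal_ne_top) ?_
    · simpa using hz1.2
    · simpa using hz2.2
    · rw [ENNReal.coe_lt_coe, ← NNReal.coe_lt_coe]
      have h1 := (hgA _ hz1.1).trans_lt (hgB _ hz2.1)
      have h2 := (hvA _ hz1.1).trans_lt (hvB _ hz2.1)
      rw [← NNReal.coe_lt_coe] at h1 h2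
      push_cast
      nlinarith
  have hne : α.prod β ≠ 0 := by
    intro h0
    rw [← Measure.measure_univ_eq_zero, Measure.prod_apply MeasurableSet.univ] at h0
    simp only [Set.preimage_univ, lintegral_const, mul_eq_zero] at h0
    rcases h0 with h0 | h0
    · rw [Measure.measure_univ_eq_zero.1 h0] at hSβ; exact hS0 (by simpa using hSβ.symm)
    · rw [Measure.measure_univ_eq_zero.1 h0] at hSα; exact hS0 (by simpa using hSα.symm)
  rw [hLHS, hRHS] at key
  refine key.not_gt (lintegral_strict_mono hne (by fun_prop) ?_ hlt)
  refine ne_top_of_le_ne_top ?_ (lintegral_mono_ae (hlt.mono fun _ h => h.le))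
  rw [← hLHS]
  exact ENNReal.mul_ne_top hST (ENNReal.add_ne_top.2 ⟨hLα, hLβ⟩)

/-- First variation: moving the particles of `α` to the positions distributed as `lam`. -/
theorem IsReducedMin.first_variation (hG : Measurable G) (hv : Measurable v)
    (hk : Measurable (Function.uncurry k)) (hs : ∀ x y, k x y = k y x)
    {μ α : Measure (ℝ × X)} [IsFiniteMeasure μ] (h : IsReducedMin G v k μ)
    (hfin : reducedEnergy G v k μ ≠ ⊤) (hmass : chargeDensity μ Set.univ ≠ ⊤) (hα : α ≤ μ)
    (lam : Measure X) [IsProbabilityMeasure lam] (hlam : mutualEnergy k lam lam ≠ ⊤) :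
    confinementEnergy G v α + 2 * mutualEnergy k (chargeDensity μ) (chargeDensity α) ≤
      (∫⁻ p, ENNReal.ofReal p.1 * G p.1 ∂α) * ∫⁻ x, v x ∂lam +
        2 * (chargeDensity α Set.univ * mutualEnergy k (chargeDensity μ) lam) := by
  have hασ : chargeDensity α ≤ chargeDensity μ := chargeDensity_mono hα
  have : IsFiniteMeasure α := isFiniteMeasure_of_le _ hα
  have : IsFiniteMeasure (chargeDensity μ) := ⟨hmass.lt_top⟩
  have : IsFiniteMeasure (chargeDensity α) := isFiniteMeasure_of_le _ hασ
  set a := chargeDensity α Set.univ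
  have haT : a ≠ ⊤ := measure_ne_top _ _
  set L := (∫⁻ p, ENNReal.ofReal p.1 * G p.1 ∂α) * ∫⁻ x, v x ∂lam
  have hmut : mutualEnergy k (chargeDensity μ) (chargeDensity μ) ≠ ⊤ :=
    ne_top_of_le_ne_top hfin le_add_self
  have hmutα : mutualEnergy k (chargeDensity α) (chargeDensity α) ≠ ⊤ :=
    ne_top_of_le_ne_top hmut (mutualEnergy_mono hασ hασ)
  -- Bound for the second-order terms in `t`. The self-energy of `α` enters because the cross energy
  -- with `μ` is compared with that with the remainder `η`; keeping it on the right avoids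
  -- subtraction in `ℝ≥0∞`.
  set R := a ^ 2 * mutualEnergy k lam lam +
    2 * mutualEnergy k (chargeDensity α) (chargeDensity α) with hR
  have hRT : R ≠ ⊤ := ENNReal.add_ne_top.2
    ⟨ENNReal.mul_ne_top (ENNReal.pow_ne_top haT) hlam, ENNReal.mul_ne_top (by simp) hmutα⟩
  have step : ∀ t : ℝ≥0, 0 < t → t ≤ 1 →
      confinementEnergy G v α + 2 * mutualEnergy k (chargeDensity μ) (chargeDensity α) ≤
        L + 2 * (a * mutualEnergy k (chargeDensity μ) lam) + t * R := by
    intro t ht ht1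
    have hT0 : (t : ℝ≥0∞) ≠ 0 := by simpa using ht.ne'
    have hTT : (t : ℝ≥0∞) ≠ ⊤ := ENNReal.coe_ne_top
    have hle : (t : ℝ≥0∞) • α ≤ μ := by
      refine le_trans ?_ hα
      intro s
      simpa using mul_le_mul_left (ENNReal.coe_le_one_iff.2 ht1) (α s)
    set η := μ - (t : ℝ≥0∞) • α
    have : IsFiniteMeasure ((t : ℝ≥0∞) • α) := isFiniteMeasure_of_le _ hle
    have hμ : η + (t : ℝ≥0∞) • α = μ := Measure.sub_add_cancel_of_le hle
    have hηle : η ≤ μ := Measure.sub_le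
    have hησ : chargeDensity η ≤ chargeDensity μ := chargeDensity_mono hηle
    have : IsFiniteMeasure (chargeDensity η) := isFiniteMeasure_of_le _ hησ
    set μ' := η + (t : ℝ≥0∞) • (α.map Prod.fst).prod lam with hμ'
    have h1 : μ'.map Prod.fst = μ.map Prod.fst := by
      rw [hμ', ← hμ, Measure.map_add _ _ measurable_fst, Measure.map_add _ _ measurable_fst,
        Measure.map_smul, Measure.map_smul, Measure.map_fst_prod, measure_univ, one_smul]
    have h2 : chargeDensity μ' = chargeDensity η + (t * a : ℝ≥0∞) • lam := by
      rw [hμ', chargeDensity_add, chargeDensity_smul, chargeDensity_prod, ← chargeDensity_univ,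
        smul_smul]
    have h3 : chargeDensity μ = chargeDensity η + (t : ℝ≥0∞) • chargeDensity α := by
      rw [← chargeDensity_smul, ← chargeDensity_add, hμ]
    have hcμ : confinementEnergy G v μ = confinementEnergy G v η +
        t * confinementEnergy G v α := by
      rw [← confinementEnergy_smul, ← confinementEnergy_add, hμ]
    have hcμ' : confinementEnergy G v μ' = confinementEnergy G v η + t * L := by
      rw [hμ', confinementEnergy_add, confinementEnergy_smul, confinementEnergy_prod hG hv,
        lintegral_map (by fun_prop) measurable_fst]
    have : SFinite ((t * a : ℝ≥0∞) • lam) := inferInstance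
    have hmμ : mutualEnergy k (chargeDensity μ) (chargeDensity μ) =
        mutualEnergy k (chargeDensity η) (chargeDensity η) +
        t * (2 * mutualEnergy k (chargeDensity η) (chargeDensity α) +
          t * mutualEnergy k (chargeDensity α) (chargeDensity α)) := by
      rw [h3, mutualEnergy_add_self hk hs, mutualEnergy_smul_left,
        mutualEnergy_smul_right hk hs, mutualEnergy_smul_right hk hs]
      ring
    have hmμ' : mutualEnergy k (chargeDensity μ') (chargeDensity μ') =
        mutualEnergy k (chargeDensity η) (chargeDensity η) +
        t * (2 * (a * mutualEnergy k (chargeDensity η) lam) +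
          t * (a ^ 2 * mutualEnergy k lam lam)) := by
      rw [h2, mutualEnergy_add_self hk hs, mutualEnergy_smul_left,
        mutualEnergy_smul_right hk hs, mutualEnergy_smul_right hk hs]
      ring
    have hcross : mutualEnergy k (chargeDensity μ) (chargeDensity α) =
        mutualEnergy k (chargeDensity η) (chargeDensity α) +
          t * mutualEnergy k (chargeDensity α) (chargeDensity α) := by
      conv_lhs => rw [h3]
      rw [mutualEnergy_add_left, mutualEnergy_smul_left]
    have hfinη : confinementEnergy G v η + mutualEnergy k (chargeDensity η) (chargeDensity η) ≠ ⊤ :=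
      ne_top_of_le_ne_top hfin (add_le_add (lintegral_mono' hηle le_rfl) (mutualEnergy_mono hησ hησ))
    have hmin := h μ' h1
    rw [reducedEnergy, reducedEnergy, hmμ, hmμ', hcμ, hcμ'] at hmin
    -- Isolates the energy of the unmoved particles, which is finite and cancels; what remains is
    -- divided by `t`.
    have hmin' : (confinementEnergy G v η + mutualEnergy k (chargeDensity η) (chargeDensity η)) +
        t * (confinementEnergy G v α + (2 * mutualEnergy k (chargeDensity η) (chargeDensity α) +
          t * mutualEnergy k (chargeDensity α) (chargeDensity α))) ≤
        (confinementEnergy G v η + mutualEnergy k (chargeDensity η) (chargeDensity η)) +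
        t * (L + (2 * (a * mutualEnergy k (chargeDensity η) lam) +
          t * (a ^ 2 * mutualEnergy k lam lam))) := by
      convert hmin using 1 <;> ring
    rw [ENNReal.add_le_add_iff_left hfinη, ENNReal.mul_le_mul_iff_right hT0 hTT] at hmin'
    rw [hcross]
    calc confinementEnergy G v α + 2 * (mutualEnergy k (chargeDensity η) (chargeDensity α) +
            t * mutualEnergy k (chargeDensity α) (chargeDensity α))
        ≤ (confinementEnergy G v α + (2 * mutualEnergy k (chargeDensity η) (chargeDensity α) +
          t * mutualEnergy k (chargeDensity α) (chargeDensity α))) +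
          2 * (t * mutualEnergy k (chargeDensity α) (chargeDensity α)) := by
          rw [mul_add, ← add_assoc, ← add_assoc]
          exact add_le_add_left le_self_add _
      _ ≤ (L + (2 * (a * mutualEnergy k (chargeDensity η) lam) +
          t * (a ^ 2 * mutualEnergy k lam lam))) +
          2 * (t * mutualEnergy k (chargeDensity α) (chargeDensity α)) := by gcongr
      _ = L + 2 * (a * mutualEnergy k (chargeDensity η) lam) + t * R := by rw [hR]; ring
      _ ≤ _ := by
          gcongr
          exact mutualEnergy_mono hησ le_rfl
  refine ENNReal.le_of_forall_pos_le_add fun ε hε _ => ?_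
  obtain ⟨R', hR'⟩ : ∃ R' : ℝ≥0, (R' : ℝ≥0∞) = R := ⟨R.toNNReal, ENNReal.coe_toNNReal hRT⟩
  -- Chosen so that `t * R' ≤ ε`; the `+ 1` covers `R' = 0`.
  set t : ℝ≥0 := min 1 (ε / (R' + 1)) with ht
  refine (step t (lt_min one_pos (by positivity)) (min_le_left _ _)).trans ?_
  gcongr
  rw [← hR', ← ENNReal.coe_mul, ENNReal.coe_le_coe]
  calc t * R' ≤ ε / (R' + 1) * (R' + 1) := by
        gcongr
        · exact min_le_right _ _
        · exact le_self_add
    _ = ε := by field_simp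

end Abstract

/-! ### Extended-real integrals with an integrable lower bound -/

/-- This is $w=s+(w-s)$ with the negative parts moved across, so that it can be integrated term by
term in `ℝ≥0∞` even where $w=+\infty$. -/
lemma toENNReal_add_ofReal_neg {w : EReal} {s : ℝ} (h : (s : EReal) ≤ w) :
    w.toENNReal + ENNReal.ofReal (-s) =
      (-w).toENNReal + ENNReal.ofReal s + (w - s).toENNReal := by
  induction w with
  | bot => simp at h
  | top => simp
  | coe r =>
    rw [EReal.coe_le_coe_iff] at h
    rw [← EReal.coe_neg, ← EReal.coe_sub]
    simp only [EReal.real_coe_toENNReal, ENNReal.ofReal]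
    norm_cast
    rw [← NNReal.coe_inj]
    push_cast
    simp only [Real.coe_toNNReal']
    rcases max_cases r 0 with h1 | h1 <;> rcases max_cases (-s) 0 with h2 | h2 <;>
      rcases max_cases (-r) 0 with h3 | h3 <;> rcases max_cases s 0 with h4 | h4 <;>
      rcases max_cases (r - s) 0 with h5 | h5 <;> linarith

lemma toENNReal_mul_sub {t s : ℝ} (ht : 0 < t) {w : EReal} (hw : w ≠ ⊥) :
    ((t : EReal) * w - ((t * s : ℝ) : EReal)).toENNReal = ENNReal.ofReal t * (w - s).toENNReal := by
  induction w with
  | bot => exact absurd rfl hw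
  | top =>
    rw [EReal.coe_mul_top_of_pos ht, EReal.top_sub_coe, EReal.top_sub_coe, EReal.toENNReal_top,
      ENNReal.mul_top (by simpa using ht)]
  | coe r =>
    rw [← EReal.coe_mul, ← EReal.coe_sub, ← EReal.coe_sub, EReal.real_coe_toENNReal,
      EReal.real_coe_toENNReal, ← ENNReal.ofReal_mul ht.le, mul_sub]

/-- Splitting off an integrable lower bound from an extended-real integral. -/
lemma extIntegral_eq_integral_add_lintegral {α : Type*} [MeasurableSpace α] {μ : Measure α}
    {f : α → EReal} {s : α → ℝ} (hf : Measurable f) (hs : Measurable s) (hsi : Integrable s μ)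
    (h : ∀ᵐ a ∂μ, (s a : EReal) ≤ f a) :
    extIntegral f μ = ((∫ a, s a ∂μ : ℝ) : EReal) +
      ((∫⁻ a, (f a - s a).toENNReal ∂μ : ℝ≥0∞) : EReal) := by
  have hfs : Measurable fun a => (f a - s a).toENNReal := by
    have : Measurable fun a => ((-s a : ℝ) : EReal) := by fun_prop
    simp_rw [sub_eq_add_neg, ← EReal.coe_neg]
    exact (hf.add this).ereal_toENNReal
  have hsum : (∫⁻ a, (f a).toENNReal ∂μ) + ∫⁻ a, ENNReal.ofReal (-s a) ∂μ =
      (∫⁻ a, (-f a).toENNReal ∂μ) + (∫⁻ a, ENNReal.ofReal (s a) ∂μ) +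
        ∫⁻ a, (f a - s a).toENNReal ∂μ := by
    rw [← lintegral_add_right _ (by fun_prop), ← lintegral_add_right _ (by fun_prop),
      ← lintegral_add_right _ hfs]
    exact lintegral_congr_ae (h.mono fun a ha => toENNReal_add_ofReal_neg ha)
  have hA : ∫⁻ a, ENNReal.ofReal (s a) ∂μ ≠ ⊤ := hsi.lintegral_lt_top.ne
  have hB : ∫⁻ a, ENNReal.ofReal (-s a) ∂μ ≠ ⊤ := hsi.neg.lintegral_lt_top.ne
  -- The negative part of `f` is dominated by that of `s`. Its integral is therefore finite, and
  -- `extIntegral` is not of the form $\infty-\infty$.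
  have hN : ∫⁻ a, (-f a).toENNReal ∂μ ≠ ⊤ := by
    refine ne_top_of_le_ne_top hB (lintegral_mono_ae (h.mono fun a ha => ?_))
    rw [← EReal.real_coe_toENNReal, EReal.coe_neg]
    exact EReal.toENNReal_le_toENNReal (EReal.neg_le_neg_iff.2 ha)
  rw [integral_eq_lintegral_pos_part_sub_lintegral_neg_part hsi, extIntegral]
  set P := ∫⁻ a, (f a).toENNReal ∂μ
  set N := ∫⁻ a, (-f a).toENNReal ∂μ
  set A := ∫⁻ a, ENNReal.ofReal (s a) ∂μ
  set B := ∫⁻ a, ENNReal.ofReal (-s a) ∂μ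
  set D := ∫⁻ a, (f a - s a).toENNReal ∂μ
  clear_value P N A B D
  lift A to ℝ≥0 using hA
  lift B to ℝ≥0 using hB
  lift N to ℝ≥0 using hN
  rcases eq_or_ne D ⊤ with hD | hD
  · have hP : P = ⊤ := by
      rw [hD] at hsum
      simpa using hsum
    rw [hP, hD, EReal.coe_ennreal_top, EReal.coe_add_top]
    rfl
  · lift D to ℝ≥0 using hD
    have hP : P ≠ ⊤ := by
      intro hP
      rw [hP, top_add] at hsum
      exact absurd hsum.symm (by norm_cast)
    lift P to ℝ≥0 using hP
    have : P + B = N + A + D := by exact_mod_cast hsum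
    have : (P : ℝ) + B = N + A + D := by exact_mod_cast this
    simp only [EReal.coe_nnreal_eq_coe_real]
    rw [← EReal.coe_sub, ← EReal.coe_add, EReal.coe_eq_coe_iff]
    simp only [ENNReal.coe_toReal]
    linarith

/-! ### Reduction of the energy to nonnegative terms -/

section

variable {d : ℕ}

/-- The interaction kernel minus its lower bound `c - ε (V x + V y)`. -/
def reducedKernel (c ε : ℝ) (V : Space d → ℝ) (W : Space d → Space d → EReal) (x y : Space d) :
    ℝ≥0∞ :=
  (W x y - ((c - ε * (V x + V y) : ℝ) : EReal)).toENNReal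

/-- The confining potential minus the lower bound `m`. -/
def reducedPotential (m : ℝ) (V : Space d → ℝ) (x : Space d) : ℝ≥0 := (V x - m).toNNReal

variable {c ε m : ℝ} {V : Space d → ℝ} {W : Space d → Space d → EReal}

lemma continuous_reducedPotential (hV : Continuous V) : Continuous (reducedPotential m V) := by
  unfold reducedPotential; fun_prop

/-- Extended-real addition is continuous wherever one summand is finite, and the subtracted bound is
real-valued even where `W` is infinite. -/
lemma continuous_reducedKernel (hV : Continuous V) (hW : IsInteraction W) :
    Continuous (Function.uncurry (reducedKernel c ε V W)) := by
  refine Continuous.ereal_toENNReal ?_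
  have h2 : Continuous fun p : Space d × Space d =>
      ((-(c - ε * (V p.1 + V p.2)) : ℝ) : EReal) :=
    continuous_coe_real_ereal.comp (by fun_prop)
  refine continuous_iff_continuousAt.2 fun p => ?_
  simp_rw [sub_eq_add_neg (W _ _), ← EReal.coe_neg]
  exact (EReal.continuousAt_add (p := (W p.1 p.2, _)) (Or.inr (EReal.coe_ne_bot _))
    (Or.inr (EReal.coe_ne_top _))).comp (f := fun p : Space d × Space d =>
      (W p.1 p.2, ((-(c - ε * (V p.1 + V p.2)) : ℝ) : EReal))) (hW.cont.prodMk h2).continuousAt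

lemma reducedKernel_comm (hW : IsInteraction W) (x y : Space d) :
    reducedKernel c ε V W x y = reducedKernel c ε V W y x := by
  rw [reducedKernel, reducedKernel, hW.symm, add_comm (V x)]

lemma reducedKernel_self (hW : IsInteraction W) (x : Space d) :
    reducedKernel c ε V W x x = ⊤ := by
  rw [reducedKernel, hW.singular, EReal.top_sub_coe, EReal.toENNReal_top]

variable {G : ℝ → ℝ≥0} {g : ℝ → ℝ} {qmin qmax a : ℝ} {δ M : ℝ≥0}

/-- Almost everywhere the weight lies between `qmin * lo > 0` and `qmax * hi`, so multiplying or
dividing by it preserves integrability. All the weighted confinement terms thus share one finiteness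
condition, integrability of `V`. -/
lemma integrable_charge_mul_iff {μ : Measure (ℝ × Space d)} (hq : 0 < qmin)
    (hμ : ∀ᵐ p ∂μ, p.1 ∈ Set.Icc qmin qmax) {w : ℝ → ℝ} (hw : Measurable w) {lo hi : ℝ}
    (hlo : 0 < lo) (hb : ∀ q ∈ Set.Icc qmin qmax, lo ≤ w q ∧ w q ≤ hi)
    (f : ℝ × Space d → ℝ) :
    Integrable (fun p => p.1 * w p.1 * f p) μ ↔ Integrable f μ := by
  constructor
  · intro h
    have h1 : Integrable (fun p => (p.1 * w p.1)⁻¹ * (p.1 * w p.1 * f p)) μ := by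
      refine h.bdd_mul (c := (qmin * lo)⁻¹) (by fun_prop) (hμ.mono fun p hp => ?_)
      have := hb _ hp
      have h2 : qmin * lo ≤ p.1 * w p.1 :=
        mul_le_mul hp.1 this.1 hlo.le (hq.le.trans hp.1)
      have h3 : 0 < qmin * lo := by positivity
      rw [Real.norm_eq_abs, abs_of_nonneg (inv_nonneg.2 (h3.le.trans h2))]
      gcongr
    refine h1.congr (hμ.mono fun p hp => ?_)
    have := hb _ hp
    have h3 : 0 < p.1 := hq.trans_le hp.1
    have h4 : 0 < w p.1 := hlo.trans_le this.1
    field_simp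
  · intro h
    refine h.bdd_mul (c := qmax * hi) (by fun_prop) (hμ.mono fun p hp => ?_)
    have := hb _ hp
    have h3 : 0 < p.1 := hq.trans_le hp.1
    have h4 : 0 < w p.1 := hlo.trans_le this.1
    rw [Real.norm_eq_abs, abs_of_nonneg (by positivity)]
    exact mul_le_mul hp.2 this.2 h4.le (h3.le.trans hp.2)

lemma confinementEnergy_eq_lintegral_ofReal {μ : Measure (ℝ × Space d)} (hq : 0 < qmin)
    (hμ : ∀ᵐ p ∂μ, p.1 ∈ Set.Icc qmin qmax) :
    confinementEnergy G (reducedPotential m V) μ =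
      ∫⁻ p, ENNReal.ofReal (p.1 * G p.1 * (V p.2 - m)) ∂μ := by
  refine lintegral_congr_ae (hμ.mono fun p hp => ?_)
  have h1 : 0 ≤ p.1 := hq.le.trans hp.1
  simp only [reducedPotential]
  rw [ENNReal.ofReal_mul (by positivity), ENNReal.ofReal_mul h1, ENNReal.ofReal_coe_nnreal]
  rfl

lemma ae_nonneg_confinement {μ : Measure (ℝ × Space d)} (hq : 0 < qmin)
    (hμ : ∀ᵐ p ∂μ, p.1 ∈ Set.Icc qmin qmax) (hm : ∀ x, m ≤ V x) :
    0 ≤ᵐ[μ] fun p : ℝ × Space d => p.1 * G p.1 * (V p.2 - m) := hμ.mono fun p hp => by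
  have h1 : 0 ≤ p.1 := hq.le.trans hp.1
  have h2 : 0 ≤ V p.2 - m := sub_nonneg.2 (hm _)
  simp only [Pi.zero_apply]
  positivity

lemma integrable_confinement_iff {μ : Measure (ℝ × Space d)} [IsFiniteMeasure μ] (hq : 0 < qmin)
    (hμ : ∀ᵐ p ∂μ, p.1 ∈ Set.Icc qmin qmax) (hG : Measurable G)
    (hδ : 0 < δ) (hδG : ∀ q, δ ≤ G q) (hGM : ∀ q, G q ≤ M) :
    Integrable (fun p : ℝ × Space d => p.1 * G p.1 * (V p.2 - m)) μ ↔
      Integrable (fun p : ℝ × Space d => V p.2) μ := by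
  rw [integrable_charge_mul_iff hq hμ (w := fun q => (G q : ℝ)) (by fun_prop) (lo := δ) (hi := M)
    (by exact_mod_cast hδ) (fun q _ => ⟨by exact_mod_cast hδG q, by exact_mod_cast hGM q⟩)]
  constructor
  · intro h
    exact (h.add (integrable_const m)).congr (ae_of_all _ fun p => sub_add_cancel _ _)
  · intro h
    exact h.sub (integrable_const m)

lemma integrable_of_confinementEnergy_ne_top {μ : Measure (ℝ × Space d)} [IsFiniteMeasure μ]
    (hq : 0 < qmin) (hμ : ∀ᵐ p ∂μ, p.1 ∈ Set.Icc qmin qmax) (hG : Measurable G)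
    (hδ : 0 < δ) (hδG : ∀ q, δ ≤ G q) (hGM : ∀ q, G q ≤ M) (hV : Continuous V)
    (hm : ∀ x, m ≤ V x) (h : confinementEnergy G (reducedPotential m V) μ ≠ ⊤) :
    Integrable (fun p : ℝ × Space d => V p.2) μ := by
  have hVm : Measurable V := hV.measurable
  refine (integrable_confinement_iff (m := m) hq hμ hG hδ hδG hGM).1 ⟨by fun_prop, ?_⟩
  rw [hasFiniteIntegral_iff_ofReal (ae_nonneg_confinement hq hμ hm),
    ← confinementEnergy_eq_lintegral_ofReal hq hμ]
  exact lt_top_iff_ne_top.2 h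

/-- The energy is a reduced energy up to a constant. -/
theorem energy_eq_reducedEnergy {μ : Measure (ℝ × Space d)} [IsProbabilityMeasure μ] (hq : 0 < qmin)
    (hμ : ∀ᵐ p ∂μ, p.1 ∈ Set.Icc qmin qmax) (ha : a = ∫ p, p.1 ∂μ) (ha0 : 0 < a)
    (hG : Measurable G)
    (hδ : 0 < δ) (hδG : ∀ q, δ ≤ G q) (hGM : ∀ q, G q ≤ M) (hε : 0 < ε)
    (hg : ∀ q ∈ Set.Icc qmin qmax, g q = G q + 2 * ε * a)
    (hV : Continuous V) (hm : ∀ x, m ≤ V x) (hW : IsInteraction W)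
    (hVW : ∀ x y, ((c - ε * (V x + V y) : ℝ) : EReal) ≤ W x y) :
    energy g V W μ = ((a ^ 2 * c + m * ∫ p, p.1 * G p.1 ∂μ : ℝ) : EReal) +
      (reducedEnergy G (reducedPotential m V) (reducedKernel c ε V W) μ : EReal) := by
  have hVm : Measurable V := hV.measurable
  -- The strength `g` is controlled only on the charge interval; `w` is a measurable function
  -- agreeing with it there, hence almost everywhere.
  set w : ℝ → ℝ := fun q => G q + 2 * ε * a with hw
  have hwm : Measurable w := by fun_prop
  have hcongr : (fun p : ℝ × Space d => p.1 * g p.1 * V p.2) =ᵐ[μ]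
      fun p => p.1 * w p.1 * V p.2 := hμ.mono fun p hp => by
    simp only [hg _ hp, hw]
  have hiff : Integrable (fun p : ℝ × Space d => p.1 * g p.1 * V p.2) μ ↔
      Integrable (fun p : ℝ × Space d => V p.2) μ := by
    rw [integrable_congr hcongr]
    refine integrable_charge_mul_iff hq hμ hwm (lo := 2 * ε * a) (hi := M + 2 * ε * a)
      (by positivity) (fun q _ => ⟨?_, ?_⟩) _
    · simp [hw]
    · have := NNReal.coe_le_coe.2 (hGM q)
      simp only [hw]; linarith
  have hiff2 := integrable_confinement_iff (m := m) (V := V) hq hμ hG hδ hδG hGM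
  have hconf := confinementEnergy_eq_lintegral_ofReal (m := m) (V := V) (G := G) hq hμ
  have hnn := ae_nonneg_confinement (G := G) hq hμ hm
  by_cases hint : Integrable (fun p : ℝ × Space d => V p.2) μ
  · have hqi : Integrable (fun p : ℝ × Space d => p.1) μ := by
      have := (integrable_charge_mul_iff (w := fun _ => 1) hq hμ measurable_const one_pos
        (hi := 1) (fun q _ => ⟨le_rfl, le_rfl⟩) (fun _ => (1 : ℝ))).2 (integrable_const 1)
      simpa using this
    have hqG : Integrable (fun p : ℝ × Space d => p.1 * G p.1) μ := by
      have := (integrable_charge_mul_iff hq hμ (w := fun q => (G q : ℝ)) (by fun_prop) (lo := δ)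
        (hi := M) (by exact_mod_cast hδ)
        (fun q _ => ⟨by exact_mod_cast hδG q, by exact_mod_cast hGM q⟩) (fun _ => (1 : ℝ))).2
        (integrable_const 1)
      simpa using this
    have hqV : Integrable (fun p : ℝ × Space d => p.1 * V p.2) μ := by
      have := (integrable_charge_mul_iff (w := fun _ => 1) hq hμ measurable_const one_pos
        (hi := 1) (fun q _ => ⟨le_rfl, le_rfl⟩) (fun p => V p.2)).2 hint
      simpa using this
    have hqGV := hiff2.2 hint
    -- The lower bound of the kernel weighted by both charges. Since the mean charge is `a`, its
    -- integral contains $-2\varepsilon a\int qV\,d\mu$, which cancels the part `2 * ε * a` of the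
    -- strength `g`.
    set s : (ℝ × Space d) × (ℝ × Space d) → ℝ :=
      fun z => z.1.1 * z.2.1 * (c - ε * (V z.1.2 + V z.2.2)) with hs
    have hs_eq : s = fun z => c * (z.1.1 * z.2.1) - ε * ((z.1.1 * V z.1.2) * z.2.1 +
        z.1.1 * (z.2.1 * V z.2.2)) := by ext z; simp only [hs]; ring
    have i1 := hqi.mul_prod hqi
    have i2 := hqV.mul_prod hqi
    have i3 := hqi.mul_prod hqV
    have i4 : Integrable (fun z : (ℝ × Space d) × (ℝ × Space d) =>
        (z.1.1 * V z.1.2) * z.2.1 + z.1.1 * (z.2.1 * V z.2.2)) (μ.prod μ) := i2.add i3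
    have hsi : Integrable s (μ.prod μ) := by
      rw [hs_eq]
      exact (i1.const_mul c).sub (i4.const_mul ε)
    have hs_int : ∫ z, s z ∂μ.prod μ = a ^ 2 * c - 2 * ε * a * ∫ p, p.1 * V p.2 ∂μ := by
      rw [hs_eq, integral_sub (i1.const_mul c) (i4.const_mul ε), integral_const_mul,
        integral_const_mul, integral_add i2 i3,
        integral_prod_mul (fun p : ℝ × Space d => p.1) (fun p : ℝ × Space d => p.1),
        integral_prod_mul (fun p : ℝ × Space d => p.1 * V p.2) (fun p : ℝ × Space d => p.1),
        integral_prod_mul (fun p : ℝ × Space d => p.1) (fun p : ℝ × Space d => p.1 * V p.2), ← ha]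
      ring
    have hpos2 : ∀ᵐ z ∂μ.prod μ, 0 < z.1.1 ∧ 0 < z.2.1 := by
      filter_upwards [Measure.quasiMeasurePreserving_fst.ae hμ,
        Measure.quasiMeasurePreserving_snd.ae hμ] with z h1 h2
      exact ⟨hq.trans_le h1.1, hq.trans_le h2.1⟩
    have hWm : Measurable fun z : (ℝ × Space d) × (ℝ × Space d) => W z.1.2 z.2.2 :=
      hW.cont.measurable.comp (f := fun z : (ℝ × Space d) × (ℝ × Space d) => (z.1.2, z.2.2))
        (by fun_prop)
    have hext := extIntegral_eq_integral_add_lintegral (μ := μ.prod μ)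
      (f := fun z : (ℝ × Space d) × (ℝ × Space d) =>
        ((z.1.1 * z.2.1 : ℝ) : EReal) * W z.1.2 z.2.2) (s := s)
      (Measurable.mul (by fun_prop) hWm) (by simp only [hs]; fun_prop) hsi
      (hpos2.mono fun z hz => by
        simp only [hs]
        rw [EReal.coe_mul (z.1.1 * z.2.1)]
        exact mul_le_mul_of_nonneg_left (hVW _ _) (by exact_mod_cast (mul_pos hz.1 hz.2).le))
    have hmut : ∫⁻ z, (((z.1.1 * z.2.1 : ℝ) : EReal) * W z.1.2 z.2.2 - (s z : EReal)).toENNReal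
        ∂μ.prod μ = mutualEnergy (reducedKernel c ε V W) (chargeDensity μ) (chargeDensity μ) := by
      have hk := (continuous_reducedKernel (c := c) (ε := ε) hV hW).measurable
      have hmass : IsFiniteMeasure (chargeDensity μ) := ⟨by
        have := lintegral_chargeDensity μ (f := fun _ => 1) measurable_const
        simp only [lintegral_const, one_mul, mul_one] at this
        rw [this]
        exact hqi.lintegral_lt_top⟩
      have e1 : ∫⁻ z, (((z.1.1 * z.2.1 : ℝ) : EReal) * W z.1.2 z.2.2 - (s z : EReal)).toENNReal
          ∂μ.prod μ = ∫⁻ z, ENNReal.ofReal z.1.1 * (ENNReal.ofReal z.2.1 *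
            reducedKernel c ε V W z.1.2 z.2.2) ∂μ.prod μ := by
        refine lintegral_congr_ae (hpos2.mono fun z hz => ?_)
        simp only [hs]
        rw [toENNReal_mul_sub (mul_pos hz.1 hz.2) (hW.ne_bot _ _), ENNReal.ofReal_mul hz.1.le,
          mul_assoc]
        rfl
      have hk' : Measurable fun z : (ℝ × Space d) × (ℝ × Space d) =>
          reducedKernel c ε V W z.1.2 z.2.2 :=
        hk.comp (f := fun z : (ℝ × Space d) × (ℝ × Space d) => (z.1.2, z.2.2)) (by fun_prop)
      rw [e1, lintegral_prod _ (by fun_prop), mutualEnergy,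
        lintegral_chargeDensity _ (measurable_potential hk _)]
      refine lintegral_congr fun p => ?_
      have hk'' : Measurable fun y => reducedKernel c ε V W p.2 y :=
        hk.comp (f := fun y => (p.2, y)) (by fun_prop)
      dsimp only
      rw [lintegral_chargeDensity _ hk'', lintegral_const_mul _ (by fun_prop)]
    have hcint : confinementEnergy G (reducedPotential m V) μ =
        ENNReal.ofReal (∫ p, p.1 * G p.1 * (V p.2 - m) ∂μ) := by
      rw [hconf, ofReal_integral_eq_lintegral_ofReal hqGV hnn]
    have hI0 : 0 ≤ ∫ p, p.1 * G p.1 * (V p.2 - m) ∂μ := integral_nonneg_of_ae hnn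
    have hsplit : ∫ p, p.1 * g p.1 * V p.2 ∂μ = (∫ p, p.1 * G p.1 * (V p.2 - m) ∂μ) +
        m * (∫ p, p.1 * G p.1 ∂μ) + 2 * ε * a * ∫ p, p.1 * V p.2 ∂μ := by
      have h5 : Integrable (fun p : ℝ × Space d =>
          p.1 * G p.1 * (V p.2 - m) + m * (p.1 * G p.1)) μ := hqGV.add (hqG.const_mul m)
      rw [← integral_const_mul, ← integral_const_mul, ← integral_add hqGV (hqG.const_mul m),
        ← integral_add h5 (hqV.const_mul _), integral_congr_ae hcongr]
      refine integral_congr_ae (ae_of_all _ fun p => ?_)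
      simp only [hw]; ring
    rw [energy, if_pos (hiff.2 hint), hext, hmut, hs_int, reducedEnergy, hcint, hsplit,
      EReal.coe_ennreal_add, EReal.coe_ennreal_ofReal, max_eq_left hI0, ← add_assoc, ← add_assoc,
      ← EReal.coe_add, ← EReal.coe_add]
    congr 2
    ring
  -- When `V` is not integrable the energy is `⊤` by convention, and so is the reduced confinement.
  · have htop : confinementEnergy G (reducedPotential m V) μ = ⊤ := by
      by_contra hne
      exact hint (integrable_of_confinementEnergy_ne_top hq hμ hG hδ hδG hGM hV hm hne)
    rw [energy, if_neg (fun h => hint (hiff.1 h)), reducedEnergy, htop, top_add,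
      EReal.coe_ennreal_top, EReal.coe_add_top]

end

/-! ### Test distributions of finite energy -/

section

open scoped Pointwise

variable {d : ℕ} {c ε m : ℝ} {V : Space d → ℝ} {W : Space d → Space d → EReal}

/-- Pairs of `K` at distance at least `‖z‖ > 0` form a compact set off the diagonal, where `W`
attains a finite maximum. So the `toReal` in the local integrability hypothesis never discards an
infinite value for `z ≠ 0`. -/
lemma IsInteraction.sSup_ne_top (hW : IsInteraction W) {K : Set (Space d)} (hK : IsCompact K)
    {z : Space d} (hz : z ≠ 0) :
    sSup {w : EReal | ∃ x ∈ K, ∃ y ∈ K, ‖z‖ ≤ ‖x - y‖ ∧ w = W x y} ≠ ⊤ := by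
  set T : Set (Space d × Space d) := (K ×ˢ K) ∩ {p | ‖z‖ ≤ ‖p.1 - p.2‖}
  have hTc : IsCompact T := (hK.prod hK).inter_right (isClosed_le (by fun_prop) (by fun_prop))
  rcases T.eq_empty_or_nonempty with h0 | h0
  · have : {w : EReal | ∃ x ∈ K, ∃ y ∈ K, ‖z‖ ≤ ‖x - y‖ ∧ w = W x y} = ∅ := by
      refine Set.eq_empty_iff_forall_notMem.2 ?_
      rintro w ⟨x, hx, y, hy, h, -⟩
      have : (x, y) ∈ T := ⟨⟨hx, hy⟩, h⟩
      rw [h0] at this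
      exact this
    rw [this, sSup_empty]
    exact bot_ne_top
  · obtain ⟨p, hp, hmax⟩ := hTc.exists_isMaxOn h0 hW.cont.continuousOn
    refine ne_top_of_le_ne_top (b := W p.1 p.2) (hW.finite_off_diag _ _ fun h => ?_) (sSup_le ?_)
    · have h2 : ‖z‖ ≤ ‖p.1 - p.2‖ := hp.2
      rw [h, sub_self, norm_zero] at h2
      exact hz (norm_le_zero_iff.1 h2)
    · rintro w ⟨x, hx, y, hy, h, rfl⟩
      exact hmax (a := (x, y)) ⟨⟨hx, hy⟩, h⟩

/-- The uniform charge distribution on a compact set has finite self-energy. -/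
lemma mutualEnergy_restrict_ne_top (hd : d ≠ 0) (hV : Continuous V) (hW : IsInteraction W)
    {K : Set (Space d)} (hK : IsCompact K) :
    mutualEnergy (reducedKernel c ε V W) (volume.restrict K) (volume.restrict K) ≠ ⊤ := by
  -- Positive dimension makes points Lebesgue-null, so the diagonal singularity can be ignored
  -- below.
  have : Nonempty (Fin d) := ⟨⟨0, Nat.pos_of_ne_zero hd⟩⟩
  set φ : Space d → ℝ := fun z =>
    (sSup {w : EReal | ∃ x ∈ K, ∃ y ∈ K, ‖z‖ ≤ ‖x - y‖ ∧ w = W x y}).toReal with hφ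
  have hloc : LocallyIntegrable φ volume := hW.locInt K hK
  have hVK : ContinuousOn (fun p : Space d × Space d => c - ε * (V p.1 + V p.2)) (K ×ˢ K) := by
    fun_prop
  obtain ⟨C, hC⟩ := (hK.prod hK).exists_bound_of_continuousOn hVK
  -- The pair `(x, y)` itself competes in the supremum defining `φ (x - y)`, and the subtracted
  -- bound is at most `C` in absolute value on `K ×ˢ K`.
  have hbound : ∀ x ∈ K, ∀ y ∈ K, x ≠ y →
      reducedKernel c ε V W x y ≤ ENNReal.ofReal |φ (x - y)| + ENNReal.ofReal C := by
    intro x hx y hy hxy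
    have h1 : W x y ≤ (φ (x - y) : EReal) :=
      (le_sSup (show W x y ∈ {w : EReal | ∃ x' ∈ K, ∃ y' ∈ K, ‖x - y‖ ≤ ‖x' - y'‖ ∧ w = W x' y'}
        from ⟨x, hx, y, hy, le_rfl, rfl⟩)).trans
        (EReal.le_coe_toReal (hW.sSup_ne_top hK (sub_ne_zero.2 hxy)))
    have h2 := hC (x, y) ⟨hx, hy⟩
    rw [Real.norm_eq_abs] at h2
    calc reducedKernel c ε V W x y
        ≤ ((φ (x - y) : EReal) - ((c - ε * (V x + V y) : ℝ) : EReal)).toENNReal :=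
          EReal.toENNReal_le_toENNReal (EReal.sub_le_sub h1 le_rfl)
      _ = ENNReal.ofReal (φ (x - y) - (c - ε * (V x + V y))) := by
          rw [← EReal.coe_sub, EReal.real_coe_toENNReal]
      _ ≤ ENNReal.ofReal (|φ (x - y)| + C) := by
          refine ENNReal.ofReal_le_ofReal ?_
          have := le_abs_self (φ (x - y))
          have := neg_abs_le (c - ε * (V x + V y))
          simp only at h2
          linarith
      _ ≤ _ := ENNReal.ofReal_add_le
  have hKK : IsCompact (K - K) := by
    rw [sub_eq_add_neg]
    exact hK.add hK.neg
  set I := ∫⁻ z in K - K, ENNReal.ofReal |φ z| with hI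
  have hIT : I ≠ ⊤ := by
    have h1 : IntegrableOn φ (K - K) := hloc.integrableOn_isCompact hKK
    exact h1.norm.lintegral_lt_top.ne
  have hvol : volume K ≠ ⊤ := hK.measure_lt_top.ne
  have hinner : ∀ x ∈ K, ∫⁻ y in K, reducedKernel c ε V W x y ≤ I + ENNReal.ofReal C * volume K := by
    intro x hx
    have hne : ∀ᵐ y ∂(volume.restrict K), y ∈ K ∧ x ≠ y := by
      have h1 : ∀ᵐ y ∂(volume : Measure (Space d)), x ≠ y := by
        rw [ae_iff]
        simp
      filter_upwards [ae_restrict_mem hK.measurableSet, ae_restrict_of_ae h1] with y h1 h2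
        using ⟨h1, h2⟩
    calc ∫⁻ y in K, reducedKernel c ε V W x y
        ≤ ∫⁻ y in K, (ENNReal.ofReal |φ (x - y)| + ENNReal.ofReal C) :=
          lintegral_mono_ae (hne.mono fun y hy => hbound x hx y hy.1 hy.2)
      _ = (∫⁻ y in K, ENNReal.ofReal |φ (x - y)|) + ENNReal.ofReal C * volume K := by
          rw [lintegral_add_right _ measurable_const, lintegral_const, Measure.restrict_apply_univ]
      _ ≤ _ := by
          gcongr
          -- The substitution `y ↦ x - y` preserves Lebesgue measure and sends `K` into `K - K`,
          -- which gives a bound uniform in `x ∈ K`.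
          rw [← lintegral_indicator hK.measurableSet, hI,
            ← lintegral_indicator hKK.measurableSet,
            ← lintegral_sub_left_eq_self
              ((K - K).indicator fun z => ENNReal.ofReal |φ z|) x]
          refine lintegral_mono fun y => ?_
          by_cases hy : y ∈ K
          · rw [Set.indicator_of_mem hy, Set.indicator_of_mem (Set.sub_mem_sub hx hy)]
          · rw [Set.indicator_of_notMem hy]
            exact zero_le
  refine ne_top_of_le_ne_top (b := (I + ENNReal.ofReal C * volume K) * volume K) ?_ ?_
  · exact ENNReal.mul_ne_top
      (ENNReal.add_ne_top.2 ⟨hIT, ENNReal.mul_ne_top ENNReal.ofReal_ne_top hvol⟩) hvol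
  · calc _ ≤ ∫⁻ _ in K, (I + ENNReal.ofReal C * volume K) :=
        setLIntegral_mono' hK.measurableSet hinner
      _ = _ := by rw [lintegral_const, Measure.restrict_apply_univ]

/-- The uniform probability distribution on a ball. -/
def uniformBall (x : Space d) (r : ℝ) : Measure (Space d) :=
  (volume (Metric.ball x r))⁻¹ • volume.restrict (Metric.ball x r)

lemma isProbabilityMeasure_uniformBall (x : Space d) {r : ℝ} (hr : 0 < r) :
    IsProbabilityMeasure (uniformBall x r) := ⟨by
  rw [uniformBall, Measure.smul_apply, Measure.restrict_apply_univ, smul_eq_mul,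
    ENNReal.inv_mul_cancel (Metric.measure_ball_pos volume x hr).ne' measure_ball_lt_top.ne]⟩

lemma ae_uniformBall_mem (x : Space d) (r : ℝ) : ∀ᵐ y ∂uniformBall x r, y ∈ Metric.ball x r :=
  Measure.ae_smul_measure (ae_restrict_mem measurableSet_ball) _

/-- Small balls replace points as targets in the first variation: a point mass would have infinite
self-energy, because the kernel is infinite on the diagonal. -/
lemma mutualEnergy_uniformBall_ne_top (hd : d ≠ 0) (hV : Continuous V) (hW : IsInteraction W)
    (x : Space d) {r : ℝ} (hr : 0 < r) :
    mutualEnergy (reducedKernel c ε V W) (uniformBall x r) (uniformBall x r) ≠ ⊤ := by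
  have h0 : (volume (Metric.ball x r))⁻¹ ≠ ⊤ :=
    ENNReal.inv_ne_top.2 (Metric.measure_ball_pos volume x hr).ne'
  have hle : volume.restrict (Metric.ball x r) ≤ volume.restrict (Metric.closedBall x r) :=
    Measure.restrict_mono Metric.ball_subset_closedBall le_rfl
  have hk := (continuous_reducedKernel (c := c) (ε := ε) hV hW).measurable
  rw [uniformBall, mutualEnergy_smul_left, mutualEnergy_smul_right hk (reducedKernel_comm hW)]
  exact ENNReal.mul_ne_top h0 (ENNReal.mul_ne_top h0 (ne_top_of_le_ne_top
    (mutualEnergy_restrict_ne_top hd hV hW (isCompact_closedBall x r)) (mutualEnergy_mono hle hle)))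

lemma lintegral_uniformBall_ne_top {v : Space d → ℝ≥0} (hv : Continuous v) (x : Space d) {r : ℝ}
    (hr : 0 < r) : ∫⁻ y, v y ∂uniformBall x r ≠ ⊤ := by
  have := isProbabilityMeasure_uniformBall x hr
  obtain ⟨C, hC⟩ := (isCompact_closedBall x r).exists_bound_of_continuousOn
    (f := fun y => (v y : ℝ)) (by fun_prop)
  refine ne_top_of_le_ne_top (b := ENNReal.ofReal C) ENNReal.ofReal_ne_top ?_
  calc ∫⁻ y, v y ∂uniformBall x r ≤ ∫⁻ _, ENNReal.ofReal C ∂uniformBall x r := by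
        refine lintegral_mono_ae ((ae_uniformBall_mem x r).mono fun y hy => ?_)
        have := hC y (Metric.ball_subset_closedBall hy)
        rw [Real.norm_eq_abs, NNReal.abs_eq] at this
        rw [← ENNReal.ofReal_coe_nnreal]
        exact ENNReal.ofReal_le_ofReal this
    _ = _ := by simp

/-! ### Minimizers of the rate function as minimizers of the reduced energy -/

/-- The data reducing the energy to nonnegative confinement and interaction: the kernel is bounded
below by `c - ε (V x + V y)`, and the strength `g` exceeds its share `2 ε ⟨q⟩` by `G`. -/
structure Reduction (qmin qmax : ℝ) (ν : Measure ℝ) (g : ℝ → ℝ) (V : Space d → ℝ)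
    (W : Space d → Space d → EReal) (c ε m : ℝ) (G : ℝ → ℝ≥0) : Prop where
  pos : 0 < qmin
  charge : ∀ᵐ q ∂ν, q ∈ Set.Icc qmin qmax
  confining : IsConfining V
  interaction : IsInteraction W
  eps_pos : 0 < ε
  kernel_ge : ∀ x y, ((c - ε * (V x + V y) : ℝ) : EReal) ≤ W x y
  le_conf : ∀ x, m ≤ V x
  measurable : Measurable G
  bounds : ∃ δ M : ℝ≥0, 0 < δ ∧ ∀ q, δ ≤ G q ∧ G q ≤ M
  strength : ∀ q ∈ Set.Icc qmin qmax, g q = G q + 2 * ε * meanCharge ν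

namespace Reduction

variable {qmin qmax : ℝ} {ν : Measure ℝ} {g : ℝ → ℝ} {G : ℝ → ℝ≥0}

lemma charge_mem (R : Reduction qmin qmax ν g V W c ε m G) {μ : Measure (ℝ × Space d)}
    (hμ : μ.map Prod.fst = ν) : ∀ᵐ p ∂μ, p.1 ∈ Set.Icc qmin qmax := by
  have := R.charge
  rw [← hμ] at this
  exact ae_of_ae_map measurable_fst.aemeasurable this

variable [IsProbabilityMeasure ν] (R : Reduction qmin qmax ν g V W c ε m G)
  {μ : Measure (ℝ × Space d)}
include R

lemma integrable_charge : Integrable (fun q : ℝ => q) ν :=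
  Integrable.of_bound (by fun_prop) qmax (R.charge.mono fun q hq => by
    rw [Real.norm_eq_abs, abs_of_nonneg (R.pos.le.trans hq.1)]
    exact hq.2)

lemma meanCharge_mem : meanCharge ν ∈ Set.Icc qmin qmax := by
  constructor
  · have := integral_mono_ae (integrable_const qmin) R.integrable_charge
      (R.charge.mono fun q hq => hq.1)
    simpa [meanCharge] using this
  · have := integral_mono_ae R.integrable_charge (integrable_const qmax)
      (R.charge.mono fun q hq => hq.2)
    simpa [meanCharge] using this

lemma meanCharge_pos : 0 < meanCharge ν := R.pos.trans_le R.meanCharge_mem.1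

lemma lintegral_charge : ∫⁻ q, ENNReal.ofReal q ∂ν = ENNReal.ofReal (meanCharge ν) := by
  rw [meanCharge, ofReal_integral_eq_lintegral_ofReal R.integrable_charge]
  exact R.charge.mono fun q hq => R.pos.le.trans hq.1

lemma chargeDensity_univ (hμ : μ.map Prod.fst = ν) :
    chargeDensity μ Set.univ = ENNReal.ofReal (meanCharge ν) := by
  rw [HeteroGas.chargeDensity_univ, hμ, R.lintegral_charge]

lemma energy_eq (hμ : μ ∈ withCharge d ν) : energy g V W μ =
    ((meanCharge ν ^ 2 * c + m * ∫ q, q * G q ∂ν : ℝ) : EReal) +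
      (reducedEnergy G (reducedPotential m V) (reducedKernel c ε V W) μ : EReal) := by
  obtain ⟨hprob, hmap⟩ := hμ
  obtain ⟨δ, M, hδ, hb⟩ := R.bounds
  have hG := R.measurable
  have h1 : meanCharge ν = ∫ p, p.1 ∂μ := by
    rw [meanCharge, ← hmap, integral_map measurable_fst.aemeasurable (by fun_prop)]
  have h2 : ∫ q, q * G q ∂ν = ∫ p, p.1 * G p.1 ∂μ := by
    rw [← hmap, integral_map measurable_fst.aemeasurable
      (by fun_prop : Measurable fun q => q * (G q : ℝ)).aestronglyMeasurable]
  rw [h2]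
  exact energy_eq_reducedEnergy R.pos (R.charge_mem hmap) h1 R.meanCharge_pos hG hδ
    (fun q => (hb q).1) (fun q => (hb q).2) R.eps_pos R.strength R.confining.cont R.le_conf
    R.interaction R.kernel_ge

/-- Placing all charges independently and uniformly in a ball costs finite energy. Hence the infimum
in the rate function is finite, and so is the energy of every minimizer. -/
lemma exists_reducedEnergy_ne_top (hd : d ≠ 0) : ∃ μ ∈ withCharge d ν,
    reducedEnergy G (reducedPotential m V) (reducedKernel c ε V W) μ ≠ ⊤ := by
  have := isProbabilityMeasure_uniformBall (0 : Space d) one_pos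
  have hv := continuous_reducedPotential (m := m) R.confining.cont
  have hk := (continuous_reducedKernel (c := c) (ε := ε) R.confining.cont R.interaction).measurable
  refine ⟨ν.prod (uniformBall 0 1), ⟨inferInstance, ?_⟩, ?_⟩
  · rw [Measure.map_fst_prod, measure_univ, one_smul]
  · rw [reducedEnergy, confinementEnergy_prod R.measurable hv.measurable, chargeDensity_prod,
      R.lintegral_charge, mutualEnergy_smul_left,
      mutualEnergy_smul_right hk (reducedKernel_comm R.interaction)]
    refine ENNReal.add_ne_top.2 ⟨ENNReal.mul_ne_top ?_ (lintegral_uniformBall_ne_top hv _ one_pos),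
      ENNReal.mul_ne_top ENNReal.ofReal_ne_top (ENNReal.mul_ne_top ENNReal.ofReal_ne_top
        (mutualEnergy_uniformBall_ne_top hd R.confining.cont R.interaction _ one_pos))⟩
    obtain ⟨δ, M, hδ, hb⟩ := R.bounds
    refine ne_top_of_le_ne_top (b := ENNReal.ofReal (meanCharge ν) * M)
      (ENNReal.mul_ne_top ENNReal.ofReal_ne_top ENNReal.coe_ne_top) ?_
    rw [← R.lintegral_charge, ← lintegral_mul_const _ (by fun_prop)]
    exact lintegral_mono fun q => by
      have := ENNReal.coe_le_coe.2 (hb q).2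
      dsimp only
      gcongr

/-- The minimizers of the rate function are the minimizers of the reduced energy. -/
theorem isEquilibrium_iff (hd : d ≠ 0) : IsEquilibrium g V W ν μ ↔ μ ∈ withCharge d ν ∧
    IsReducedMin G (reducedPotential m V) (reducedKernel c ε V W) μ := by
  refine and_congr_right fun hμ => ?_
  set C : ℝ := meanCharge ν ^ 2 * c + m * ∫ q, q * G q ∂ν
  set Φ := reducedEnergy G (reducedPotential m V) (reducedKernel c ε V W)
  have hE : ∀ μ ∈ withCharge d ν, energy g V W μ = (C : EReal) + (Φ μ : EReal) :=
    fun μ hμ => R.energy_eq hμ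
  set r := ⨅ μ' ∈ withCharge d ν, energy g V W μ' with hr
  -- Only for a real infimum does subtracting it preserve and reflect the order of energies.
  have hr_bot : r ≠ ⊥ := by
    refine ne_bot_of_le_ne_bot (EReal.coe_ne_bot C) (le_iInf₂ fun μ' hμ' => ?_)
    rw [hE _ hμ']
    exact le_add_of_nonneg_right (EReal.coe_ennreal_nonneg _)
  have hr_top : r ≠ ⊤ := by
    obtain ⟨μ₀, hμ₀, hfin⟩ := R.exists_reducedEnergy_ne_top hd
    refine ne_top_of_le_ne_top ?_ (iInf₂_le μ₀ hμ₀)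
    rw [hE _ hμ₀]
    exact EReal.add_ne_top (EReal.coe_ne_top _) (by simpa using hfin)
  have hiff : ∀ μ' ∈ withCharge d ν, (rateFunction g V W ν μ ≤ rateFunction g V W ν μ' ↔
      Φ μ ≤ Φ μ') := by
    intro μ' hμ'
    rw [rateFunction, rateFunction, ← hr, hE _ hμ, hE _ hμ']
    clear_value r
    lift r to ℝ using ⟨hr_top, hr_bot⟩
    constructor
    · intro h
      have h1 := add_le_add_left h (r : EReal)
      rw [EReal.sub_add_cancel, EReal.sub_add_cancel] at h1
      have h2 := add_le_add_right h1 ((-C : ℝ) : EReal)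
      rw [← add_assoc, ← add_assoc, ← EReal.coe_add, neg_add_cancel, EReal.coe_zero, zero_add,
        zero_add] at h2
      exact_mod_cast h2
    · intro h
      exact EReal.sub_le_sub (add_le_add_right (by exact_mod_cast h) _) le_rfl
  constructor
  · intro h μ' hμ'
    -- A measure with charge marginal `ν` is automatically a probability measure, so both
    -- minimization problems have the same competitors.
    have hmem : μ' ∈ withCharge d ν := by
      have h1 : μ'.map Prod.fst = ν := hμ'.trans hμ.2
      refine ⟨⟨?_⟩, h1⟩
      have : (μ'.map Prod.fst) Set.univ = 1 := by rw [h1]; exact measure_univ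
      rwa [Measure.map_apply measurable_fst MeasurableSet.univ] at this
    exact (hiff μ' hmem).1 (h hmem)
  · intro h μ' hμ'
    exact (hiff μ' hμ').2 (h μ' (hμ'.2.trans hμ.2.symm))

lemma reducedEnergy_ne_top (hd : d ≠ 0) (hμ : μ ∈ withCharge d ν)
    (h : IsReducedMin G (reducedPotential m V) (reducedKernel c ε V W) μ) :
    reducedEnergy G (reducedPotential m V) (reducedKernel c ε V W) μ ≠ ⊤ := by
  obtain ⟨μ₀, hμ₀, hfin⟩ := R.exists_reducedEnergy_ne_top hd
  exact ne_top_of_le_ne_top hfin (h μ₀ (hμ₀.2.trans hμ.2.symm))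

end Reduction

/-- A bounded measurable strength dominating the interaction yields a reduction. -/
lemma exists_reduction {qmin qmax : ℝ} {ν : Measure ℝ} {g : ℝ → ℝ} (hq : 0 < qmin)
    (hle : qmin ≤ qmax)
    (hν : ν (Set.Icc qmin qmax)ᶜ = 0) (hV : IsConfining V) (hW : IsInteraction W)
    (hVW : Dominates (Set.Icc qmin qmax) ν g V W)
    (hgm : Measurable fun q => g (Set.projIcc qmin qmax hle q))
    {q₁ q₂ : ℝ} (hq₁ : q₁ ∈ Set.Icc qmin qmax)
    (hg : ∀ q ∈ Set.Icc qmin qmax, g q₁ ≤ g q ∧ g q ≤ g q₂) :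
    ∃ c ε m, Reduction qmin qmax ν g V W c ε m
      (fun q => (g (Set.projIcc qmin qmax hle q) - 2 * ε * meanCharge ν).toNNReal) := by
  obtain ⟨c, ε, hε, hdom, hker⟩ := hVW
  obtain ⟨x, hx⟩ := hV.cont.exists_forall_le hV.tendsto
  -- Projecting onto the charge interval extends `g` by its endpoint values, so bounds on the
  -- interval become global. The lower one is positive because `2 * ε * meanCharge ν < g q₁`.
  refine ⟨c, ε, V x, hq, (by rw [ae_iff]; exact hν), hV, hW, hε, hker, hx,
    (hgm.sub_const _).real_toNNReal,
    ⟨(g q₁ - 2 * ε * meanCharge ν).toNNReal, (g q₂ - 2 * ε * meanCharge ν).toNNReal, ?_,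
      fun q => ⟨?_, ?_⟩⟩, fun q hq' => ?_⟩
  · simpa using hdom q₁ hq₁
  · exact Real.toNNReal_le_toNNReal (sub_le_sub_right (hg _ (Subtype.coe_prop _)).1 _)
  · exact Real.toNNReal_le_toNNReal (sub_le_sub_right (hg _ (Subtype.coe_prop _)).2 _)
  · rw [Set.projIcc_of_mem hle hq', Real.coe_toNNReal _ (sub_nonneg.2 (hdom q hq').le)]
    ring

end

/-! ### Stationarity and differentiability of the potential -/

section

/-- A function exceeding its value at `z` at points arbitrarily close to every point near `z` has
zero derivative at `z`. -/
lemma hasFDerivAt_eq_zero_of_dense {E : Type*} [NormedAddCommGroup E] [NormedSpace ℝ E] {f : E → ℝ}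
    {f' : E →L[ℝ] ℝ} {z : E} (hf : HasFDerivAt f f' z)
    (h : ∀ᶠ U in (𝓝 z).smallSets, ∀ O ⊆ U, IsOpen O → O.Nonempty → ∃ y ∈ O, f z ≤ f y) :
    f' = 0 := by
  have key : ∀ w, 0 ≤ f' w := by
    intro w
    by_contra! hw
    obtain ⟨U, hU, hUO⟩ := eventually_smallSets.1 h
    -- If `f' w < 0`, this tolerance keeps the first-order error below `t * (-f' w / 4)`. The linear
    -- part is below `t * (f' w / 2)` near the direction `w`, so `f` stays under `f z` on an entire
    -- ball near `z + t • w`, contrary to `h`.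
    set η : ℝ := -f' w / (4 * (‖w‖ + 1)) with hη
    have hη0 : 0 < η := by have := norm_nonneg w; exact div_pos (by linarith) (by positivity)
    obtain ⟨r, hr, hball⟩ := Metric.mem_nhds_iff.1
      (inter_mem hU (hf.isLittleO.bound hη0))
    have hcont : ∀ᶠ w' in 𝓝 w, f' w' < f' w / 2 :=
      f'.continuous.continuousAt.eventually_lt continuousAt_const (by linarith)
    obtain ⟨ρ, hρ, hρball⟩ := Metric.mem_nhds_iff.1 hcont
    set ρ' := min ρ 1 with hρ'
    have hρ'0 : 0 < ρ' := lt_min hρ one_pos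
    have hw1 : 0 < ‖w‖ + 1 := by positivity
    -- With `‖w'‖ ≤ ‖w‖ + 1` all the displaced points stay within `r / 2` of `z`.
    set t : ℝ := r / (2 * (‖w‖ + 1)) with ht
    have ht0 : 0 < t := by positivity
    have hO : ∀ y ∈ Metric.ball (z + t • w) (t * ρ'), ∃ w' ∈ Metric.ball w ρ', y = z + t • w' := by
      intro y hy
      refine ⟨t⁻¹ • (y - z), ?_, ?_⟩
      · rw [Metric.mem_ball, dist_eq_norm] at hy ⊢
        have : t⁻¹ • (y - z) - w = t⁻¹ • (y - (z + t • w)) := by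
          rw [← sub_sub, smul_sub t⁻¹ (y - z), smul_smul, inv_mul_cancel₀ ht0.ne', one_smul]
        rw [this, norm_smul, norm_inv, Real.norm_of_nonneg ht0.le, inv_mul_lt_iff₀ ht0]
        exact hy
      · rw [smul_smul, mul_inv_cancel₀ ht0.ne', one_smul, add_sub_cancel]
    have hnorm : ∀ w' ∈ Metric.ball w ρ', ‖w'‖ ≤ ‖w‖ + 1 := by
      intro w' hw'
      rw [Metric.mem_ball, dist_eq_norm] at hw'
      have := norm_sub_norm_le w' w
      have := hw'.le.trans (min_le_right ρ 1)
      linarith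
    have hsub : Metric.ball (z + t • w) (t * ρ') ⊆ Metric.ball z r := by
      intro y hy
      obtain ⟨w', hw', rfl⟩ := hO y hy
      rw [Metric.mem_ball, dist_eq_norm, add_sub_cancel_left, norm_smul, Real.norm_of_nonneg ht0.le]
      calc t * ‖w'‖ ≤ t * (‖w‖ + 1) := by gcongr; exact hnorm w' hw'
        _ = r / 2 := by rw [ht]; field_simp
        _ < r := by linarith
    obtain ⟨y, hy, hle⟩ := hUO U subset_rfl _ (hsub.trans fun y hy => (hball hy).1)
      Metric.isOpen_ball (Metric.nonempty_ball.2 (by positivity))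
    have hbd := (hball (hsub hy)).2
    obtain ⟨w', hw', rfl⟩ := hO y hy
    have hw'2 : f' w' < f' w / 2 := hρball (Metric.ball_subset_ball (min_le_left _ _) hw')
    simp only [Set.mem_ofPred_eq, add_sub_cancel_left, map_smul, smul_eq_mul, norm_smul,
      Real.norm_of_nonneg ht0.le] at hbd
    have h1 := (le_abs_self _).trans hbd
    have h2 : η * (t * ‖w'‖) ≤ t * (-f' w / 4) := by
      calc η * (t * ‖w'‖) ≤ η * (t * (‖w‖ + 1)) := by gcongr; exact hnorm w' hw'
        _ = t * (-f' w / 4) := by rw [hη]; field_simp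
    have h3 : t * f' w' < t * (f' w / 2) := by gcongr
    nlinarith
  ext w
  have h1 := key w
  have h2 := key (-w)
  rw [map_neg] at h2
  simp only [zero_apply]
  linarith

lemma le_of_dense_of_continuousAt {E : Type*} [TopologicalSpace E] {φ : E → ℝ≥0∞} {F : ℝ≥0∞}
    {z : E} (hφ : ContinuousAt φ z)
    (h : ∀ O : Set E, IsOpen O → O.Nonempty → ∃ y ∈ O, F ≤ φ y) : F ≤ φ z := by
  by_contra! hlt
  obtain ⟨O, hO, hOo, hz⟩ := mem_nhds_iff.1 (hφ.eventually_lt continuousAt_const hlt)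
  obtain ⟨y, hy, hle⟩ := h O hOo ⟨z, hz⟩
  exact (hO hy).not_ge hle

namespace Reduction

variable {d : ℕ} {c ε m : ℝ} {V : Space d → ℝ} {W : Space d → Space d → EReal}
  {qmin qmax : ℝ} {ν : Measure ℝ} {g : ℝ → ℝ} {G : ℝ → ℝ≥0} {μ : Measure (ℝ × Space d)}

/-- A charge distribution of finite self-energy has no atoms. -/
lemma measure_singleton_eq_zero (hW : IsInteraction W) {σ : Measure (Space d)}
    (hfin : mutualEnergy (reducedKernel c ε V W) σ σ ≠ ⊤) (y : Space d) : σ {y} = 0 := by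
  by_contra h0
  refine hfin (top_le_iff.1 ?_)
  calc (⊤ : ℝ≥0∞) = mutualEnergy (reducedKernel c ε V W) (σ.restrict {y}) (σ.restrict {y}) := by
        rw [mutualEnergy, Measure.restrict_singleton, lintegral_smul_measure, lintegral_dirac,
          lintegral_smul_measure, lintegral_dirac, reducedKernel_self hW]
        simp [h0]
    _ ≤ mutualEnergy (reducedKernel c ε V W) σ σ :=
        mutualEnergy_mono Measure.restrict_le_self Measure.restrict_le_self

lemma integrable_potential (R : Reduction qmin qmax ν g V W c ε m G) (hμ : μ ∈ withCharge d ν)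
    (hfin : reducedEnergy G (reducedPotential m V) (reducedKernel c ε V W) μ ≠ ⊤) :
    Integrable (fun p : ℝ × Space d => p.1 * V p.2) μ := by
  have := hμ.1
  obtain ⟨δ, M, hδ, hb⟩ := R.bounds
  have h1 := integrable_of_confinementEnergy_ne_top R.pos (R.charge_mem hμ.2) R.measurable hδ
    (fun q => (hb q).1) (fun q => (hb q).2) R.confining.cont R.le_conf
    (ne_top_of_le_ne_top hfin le_self_add)
  simpa using (integrable_charge_mul_iff (w := fun _ => 1) R.pos (R.charge_mem hμ.2)
    measurable_const one_pos (hi := 1) (fun q _ => ⟨le_rfl, le_rfl⟩) (fun p => V p.2)).2 h1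

/-- Where forces are defined, the potential of the reduced kernel is a real function, differentiable
at the point. -/
lemma exists_potential_eq_ofReal (R : Reduction qmin qmax ν g V W c ε m G)
    (hμ : μ ∈ withCharge d ν)
    (hfin : reducedEnergy G (reducedPotential m V) (reducedKernel c ε V W) μ ≠ ⊤)
    {x : Space d} (hx : HasForces V W μ x) :
    ∃ u : Space d → ℝ, DifferentiableAt ℝ u x ∧ ∀ᶠ y in 𝓝 x, 0 ≤ u y ∧
      ∫⁻ x', reducedKernel c ε V W y x' ∂chargeDensity μ = ENNReal.ofReal (u y) := by
  have hprob := hμ.1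
  have hcm := R.charge_mem hμ.2
  have hqV := R.integrable_potential hμ hfin
  have hqi : Integrable (fun p : ℝ × Space d => p.1) μ := by
    simpa using (integrable_charge_mul_iff (w := fun _ => 1) R.pos hcm measurable_const one_pos
      (hi := 1) (fun q _ => ⟨le_rfl, le_rfl⟩) (fun _ => (1 : ℝ))).2 (integrable_const 1)
  have hk := (continuous_reducedKernel (c := c) (ε := ε) R.confining.cont R.interaction).measurable
  set a := ∫ p, p.1 ∂μ
  set J := ∫ p, p.1 * V p.2 ∂μ
  -- This is $\int q'\,(W(y,x')-c+\varepsilon V(y)+\varepsilon V(x'))\,d\mu$ with the constant and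
  -- confinement terms integrated out.
  refine ⟨fun y => chargePotential W μ y - (c - ε * V y) * a + ε * J, ?_, ?_⟩
  · exact ((hx.diff_pot.sub ((((hx.diff_conf.const_mul ε).const_sub c)).mul_const a)).add_const _)
  filter_upwards [hx.integrable_near] with y hy
  -- Finite self-energy excludes an atom at `y`, so `W y p.2` is finite almost everywhere and its
  -- `toReal` is the true value.
  have hne : ∀ᵐ p ∂μ, p.2 ≠ y := by
    have h0 := measure_singleton_eq_zero R.interaction (ne_top_of_le_ne_top hfin le_add_self) y
    rw [← lintegral_indicator_one (measurableSet_singleton y), lintegral_chargeDensity _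
      (measurable_one.indicator (measurableSet_singleton y))] at h0
    replace h0 := (lintegral_eq_zero_iff (f := fun p : ℝ × Space d => ENNReal.ofReal p.1 *
      ({y} : Set (Space d)).indicator 1 p.2) (measurable_ofReal_fst.mul
        ((measurable_one.indicator (measurableSet_singleton y)).comp measurable_snd))).1 h0
    filter_upwards [h0, hcm] with p hp hp' hpy
    have hpos := R.pos.trans_le hp'.1
    simp [hpy] at hp
    linarith
  have hpt : ∀ᵐ p ∂μ, 0 ≤ p.1 * ((W y p.2).toReal - (c - ε * (V y + V p.2))) ∧
      ENNReal.ofReal p.1 * reducedKernel c ε V W y p.2 =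
        ENNReal.ofReal (p.1 * ((W y p.2).toReal - (c - ε * (V y + V p.2)))) := by
    filter_upwards [hne, hcm] with p hp hp'
    have hpos := R.pos.trans_le hp'.1
    have hker := R.kernel_ge y p.2
    have hbot := R.interaction.ne_bot y p.2
    have htop := R.interaction.finite_off_diag y p.2 hp.symm
    rw [reducedKernel]
    lift W y p.2 to ℝ using ⟨htop, hbot⟩ with w
    rw [EReal.coe_le_coe_iff] at hker
    rw [← EReal.coe_sub, EReal.real_coe_toENNReal, EReal.toReal_coe, ← ENNReal.ofReal_mul hpos.le]
    exact ⟨mul_nonneg hpos.le (by linarith), rfl⟩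
  have hsplit : ∀ p : ℝ × Space d, p.1 * ((W y p.2).toReal - (c - ε * (V y + V p.2))) =
      p.1 * (W y p.2).toReal - (c - ε * V y) * p.1 + ε * (p.1 * V p.2) := fun p => by ring
  have i1 := hy.sub (hqi.const_mul (c - ε * V y))
  have i2 := i1.add (hqV.const_mul ε)
  have hint : ∫ p, p.1 * ((W y p.2).toReal - (c - ε * (V y + V p.2))) ∂μ =
      chargePotential W μ y - (c - ε * V y) * a + ε * J := by
    simp_rw [hsplit]
    have i3 : Integrable (fun p : ℝ × Space d =>
      p.1 * (W y p.2).toReal - (c - ε * V y) * p.1) μ := i1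
    rw [integral_add i3 (hqV.const_mul ε), integral_sub hy (hqi.const_mul _), integral_const_mul,
      integral_const_mul]
    rfl
  have i4 : Integrable
      (fun p : ℝ × Space d => p.1 * ((W y p.2).toReal - (c - ε * (V y + V p.2)))) μ := by
    simp_rw [hsplit]
    exact i2
  rw [← hint]
  refine ⟨integral_nonneg_of_ae (hpt.mono fun p hp => hp.1), ?_⟩
  have hky : Measurable fun x' => reducedKernel c ε V W y x' :=
    hk.comp (f := fun x' => (y, x')) (by fun_prop)
  rw [lintegral_chargeDensity _ hky, ofReal_integral_eq_lintegral_ofReal i4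
    (hpt.mono fun p hp => hp.1)]
  exact lintegral_congr_ae (hpt.mono fun p hp => hp.2)

end Reduction

end

/-! ### Equilibrium condition at points of the support -/

section

section Abstract

variable {d : ℕ} {G : ℝ → ℝ≥0} {v : Space d → ℝ≥0} {k : Space d → Space d → ℝ≥0∞}
  {μ : Measure (ℝ × Space d)}

/-- Averaged first variation near a point of the support. -/
lemma IsReducedMin.exists_average_strength [IsFiniteMeasure μ] (hG : Measurable G)
    (hv : Continuous v)
    (hk : Measurable (Function.uncurry k)) (hs : ∀ x y, k x y = k y x)
    (h : IsReducedMin G v k μ) (hfin : reducedEnergy G v k μ ≠ ⊤) (hpos : ∀ᵐ p ∂μ, 0 < p.1)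
    (hmass : chargeDensity μ Set.univ ≠ ⊤) {p : ℝ × Space d} (hp : p ∈ μ.support) {lo hi : ℝ≥0}
    (hG' : ∀ᶠ q in 𝓝 p.1, lo ≤ G q ∧ G q ≤ hi) {v₀ u₀ : ℝ≥0} (hv₀ : ∀ᶠ y in 𝓝 p.2, v₀ ≤ v y)
    (hu₀ : ∀ᶠ y in 𝓝 p.2, (u₀ : ℝ≥0∞) ≤ ∫⁻ x', k y x' ∂chargeDensity μ) :
    ∃ γ ∈ Set.Icc lo hi, ∀ lam : Measure (Space d), IsProbabilityMeasure lam →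
      mutualEnergy k lam lam ≠ ⊤ → ((γ * v₀ + 2 * u₀ : ℝ≥0) : ℝ≥0∞) ≤
        γ * ∫⁻ y, v y ∂lam + 2 * mutualEnergy k (chargeDensity μ) lam := by
  have hN : {z : ℝ × Space d | (lo ≤ G z.1 ∧ G z.1 ≤ hi) ∧ v₀ ≤ v z.2 ∧
      (u₀ : ℝ≥0∞) ≤ ∫⁻ x', k z.2 x' ∂chargeDensity μ} ∈ 𝓝 p := by
    rw [show 𝓝 p = 𝓝 p.1 ×ˢ 𝓝 p.2 from nhds_prod_eq]
    exact (hG'.prod_inl _).and ((hv₀.prod_inr _).and (hu₀.prod_inr _))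
  -- All the local bounds hold on one open neighbourhood of `p`, which has positive mass because `p`
  -- is in the support; its particles are the ones to be moved.
  obtain ⟨A, hAN, hAo, hpA⟩ := mem_nhds_iff.1 hN
  have hA := hAo.measurableSet
  have hA0 : μ A ≠ 0 := ((Measure.mem_support_iff_forall p).1 hp A (hAo.mem_nhds hpA)).ne'
  set α := μ.restrict A
  have hαμ : α ≤ μ := Measure.restrict_le_self
  set a := ∫⁻ p, ENNReal.ofReal p.1 ∂α with ha
  have ha' : chargeDensity α Set.univ = a := by
    rw [chargeDensity_univ, lintegral_map (by fun_prop) measurable_fst]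
  have ha0 : a ≠ 0 := ha' ▸ chargeDensity_restrict_ne_zero hpos hA0
  have haT : a ≠ ⊤ := by
    rw [← ha']
    exact ne_top_of_le_ne_top hmass (chargeDensity_mono hαμ _)
  have haeA : ∀ᵐ z ∂α, z ∈ A := ae_restrict_mem hA
  have : IsFiniteMeasure (chargeDensity μ) := ⟨hmass.lt_top⟩
  have : IsFiniteMeasure (chargeDensity α) := isFiniteMeasure_of_le _ (chargeDensity_mono hαμ)
  set b := ∫⁻ p, ENNReal.ofReal p.1 * G p.1 ∂α with hb
  have hlo : lo * a ≤ b := by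
    rw [ha, ← lintegral_const_mul _ (by fun_prop)]
    refine lintegral_mono_ae (haeA.mono fun z hz => ?_)
    rw [mul_comm]
    have := ENNReal.coe_le_coe.2 (hAN hz).1.1
    gcongr
  have hhi : b ≤ hi * a := by
    rw [ha, ← lintegral_const_mul _ (by fun_prop)]
    refine lintegral_mono_ae (haeA.mono fun z hz => ?_)
    rw [mul_comm]
    have := ENNReal.coe_le_coe.2 (hAN hz).1.2
    gcongr
  have hbT : b ≠ ⊤ := ne_top_of_le_ne_top (ENNReal.mul_ne_top ENNReal.coe_ne_top haT) hhi
  -- The charge-weighted average of `G` over the moved particles. It does not depend on the target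
  -- `lam`, and dividing the first variation by their charge `a` leaves only `γ`.
  obtain ⟨γ, hγ⟩ : ∃ γ : ℝ≥0, (γ : ℝ≥0∞) = b / a :=
    ⟨(b / a).toNNReal, ENNReal.coe_toNNReal (ENNReal.div_ne_top hbT ha0)⟩
  have hγb : b = γ * a := by rw [hγ, ENNReal.div_mul_cancel ha0 haT]
  refine ⟨γ, ⟨?_, ?_⟩, fun lam hlam hlamT => ?_⟩
  · rw [← ENNReal.coe_le_coe, hγ]
    exact (ENNReal.le_div_iff_mul_le (Or.inl ha0) (Or.inl haT)).2 hlo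
  · rw [← ENNReal.coe_le_coe, hγ]
    exact ENNReal.div_le_of_le_mul hhi
  have key := h.first_variation hG hv.measurable hk hs hfin hmass hαμ lam hlamT
  have h1 : v₀ * b ≤ confinementEnergy G v α := by
    rw [hb, ← lintegral_const_mul _ (by fun_prop)]
    refine lintegral_mono_ae (haeA.mono fun z hz => ?_)
    rw [mul_comm]
    have := ENNReal.coe_le_coe.2 (hAN hz).2.1
    gcongr
  have h2 : u₀ * a ≤ mutualEnergy k (chargeDensity μ) (chargeDensity α) := by
    rw [mutualEnergy_comm hk hs, mutualEnergy, lintegral_chargeDensity _ (measurable_potential hk _),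
      ha, ← lintegral_const_mul _ (by fun_prop)]
    refine lintegral_mono_ae (haeA.mono fun z hz => ?_)
    rw [mul_comm]
    have := (hAN hz).2.2
    gcongr
  rw [ha', ← hb] at key
  refine (ENNReal.mul_le_mul_iff_right ha0 haT).1 ?_
  calc a * ((γ * v₀ + 2 * u₀ : ℝ≥0) : ℝ≥0∞) = v₀ * b + 2 * (u₀ * a) := by
        rw [hγb]; push_cast; ring
    _ ≤ confinementEnergy G v α + 2 * mutualEnergy k (chargeDensity μ) (chargeDensity α) := by
        gcongr
    _ ≤ _ := key
    _ = _ := by rw [hγb]; ring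

/-- Equilibrium condition: for a particle of the support at a point where the potential of the
charges is finite and continuous, some effective strength between the bounds of `G` makes its
effective potential minimal there. -/
theorem IsReducedMin.exists_effective_strength [IsFiniteMeasure μ] (hG : Measurable G)
    (hv : Continuous v)
    (hk : Measurable (Function.uncurry k)) (hs : ∀ x y, k x y = k y x)
    (hball : ∀ (x : Space d) (r : ℝ), 0 < r →
      mutualEnergy k (uniformBall x r) (uniformBall x r) ≠ ⊤)
    (h : IsReducedMin G v k μ) (hfin : reducedEnergy G v k μ ≠ ⊤) (hpos : ∀ᵐ p ∂μ, 0 < p.1)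
    (hmass : chargeDensity μ Set.univ ≠ ⊤) {p : ℝ × Space d} (hp : p ∈ μ.support) {lo hi : ℝ≥0}
    (hG' : ∀ᶠ q in 𝓝 p.1, lo ≤ G q ∧ G q ≤ hi)
    (hu : ContinuousAt (fun y => ∫⁻ x', k y x' ∂chargeDensity μ) p.2)
    (huT : ∫⁻ x', k p.2 x' ∂chargeDensity μ ≠ ⊤) :
    ∃ γ ∈ Set.Icc lo hi, ∀ O : Set (Space d), IsOpen O → O.Nonempty → ∃ y ∈ O,
      γ * v p.2 + 2 * ∫⁻ x', k p.2 x' ∂chargeDensity μ ≤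
        (γ * v y + 2 * ∫⁻ x', k y x' ∂chargeDensity μ : ℝ≥0∞) := by
  set u : Space d → ℝ≥0∞ := fun y => ∫⁻ x', k y x' ∂chargeDensity μ
  have : IsFiniteMeasure (chargeDensity μ) := ⟨hmass.lt_top⟩
  have hum : Measurable u := measurable_potential hk _
  set v₁ := v p.2
  set u₁ := (u p.2).toNNReal
  have hu₁' : (u₁ : ℝ≥0∞) = u p.2 := ENNReal.coe_toNNReal huT
  -- Continuity gives the lower bounds near `p.2` only with a loss, here `1 / (n + 1)`; truncated
  -- subtraction covers zero values. The average strengths depend on `n`, and compactness of `Icc lo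
  -- hi` supplies a limit `γ₀` valid for all targets.
  have hstep : ∀ n : ℕ, ∃ γ ∈ Set.Icc lo hi, ∀ lam : Measure (Space d), IsProbabilityMeasure lam →
      mutualEnergy k lam lam ≠ ⊤ →
      ((γ * (v₁ - 1 / ((n : ℝ≥0) + 1)) + 2 * (u₁ - 1 / ((n : ℝ≥0) + 1)) : ℝ≥0) : ℝ≥0∞) ≤
        γ * ∫⁻ y, v y ∂lam + 2 * mutualEnergy k (chargeDensity μ) lam := by
    intro n
    have hn : (0 : ℝ≥0) < 1 / ((n : ℝ≥0) + 1) := by positivity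
    refine h.exists_average_strength hG hv hk hs hfin hpos hmass hp hG' ?_ ?_
    · rcases eq_or_ne v₁ 0 with h0 | h0
      · simp [h0]
      · exact (hv.continuousAt.eventually_const_lt
          (tsub_lt_self (pos_iff_ne_zero.2 h0) hn)).mono fun y hy => hy.le
    · rcases eq_or_ne u₁ 0 with h0 | h0
      · simp [h0]
      · refine (hu.eventually_const_lt ?_).mono fun y hy => hy.le
        change _ < u p.2
        rw [← hu₁', ENNReal.coe_lt_coe]
        exact tsub_lt_self (pos_iff_ne_zero.2 h0) hn
  choose γ hγ hγle using hstep
  obtain ⟨γ₀, hγ₀, φ, hφ, hlim⟩ := isCompact_Icc.tendsto_subseq hγ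
  refine ⟨γ₀, hγ₀, fun O hO hO0 => ?_⟩
  -- If the effective potential were smaller throughout `O`, its average over a ball inside `O`
  -- would violate the limiting inequality.
  by_contra! hlt
  obtain ⟨x, hx⟩ := hO0
  obtain ⟨r, hr, hrO⟩ := Metric.isOpen_iff.1 hO x hx
  have hprob := isProbabilityMeasure_uniformBall x hr
  set lam := uniformBall x r
  have hvT : ∫⁻ y, v y ∂lam ≠ ⊤ := lintegral_uniformBall_ne_top hv x hr
  have hδ : Tendsto (fun n : ℕ => 1 / ((φ n : ℝ≥0) + 1)) atTop (𝓝 0) :=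
    (tendsto_one_div_add_atTop_nhds_zero_nat (𝕜 := ℝ≥0)).comp hφ.tendsto_atTop
  have hL : Tendsto (fun n => ((γ (φ n) * (v₁ - 1 / ((φ n : ℝ≥0) + 1)) +
      2 * (u₁ - 1 / ((φ n : ℝ≥0) + 1)) : ℝ≥0) : ℝ≥0∞)) atTop
      (𝓝 ((γ₀ * (v₁ - 0) + 2 * (u₁ - 0) : ℝ≥0) : ℝ≥0∞)) :=
    ENNReal.tendsto_coe.2 ((hlim.mul (tendsto_const_nhds.sub hδ)).add
      (tendsto_const_nhds.mul (tendsto_const_nhds.sub hδ)))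
  have hRT : Tendsto (fun n => (γ (φ n) : ℝ≥0∞) * ∫⁻ y, v y ∂lam +
      2 * mutualEnergy k (chargeDensity μ) lam) atTop (𝓝 (γ₀ * ∫⁻ y, v y ∂lam +
      2 * mutualEnergy k (chargeDensity μ) lam)) :=
    (ENNReal.Tendsto.mul_const (ENNReal.tendsto_coe.2 hlim) (Or.inr hvT)).add tendsto_const_nhds
  have hle := le_of_tendsto_of_tendsto' hL hRT fun n =>
    hγle (φ n) lam hprob (hball x r hr)
  rw [tsub_zero, tsub_zero, ENNReal.coe_add, ENNReal.coe_mul, ENNReal.coe_mul, hu₁',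
    mutualEnergy_comm hk hs] at hle
  have hint : γ₀ * ∫⁻ y, v y ∂lam + 2 * mutualEnergy k lam (chargeDensity μ) =
      ∫⁻ y, (γ₀ * v y + 2 * u y : ℝ≥0∞) ∂lam := by
    rw [lintegral_add_right _ (by fun_prop), lintegral_const_mul _ (by fun_prop),
      lintegral_const_mul _ hum]
    rfl
  rw [hint] at hle
  have hM : γ₀ * v₁ + 2 * u p.2 ≠ ⊤ :=
    ENNReal.add_ne_top.2 ⟨ENNReal.mul_ne_top ENNReal.coe_ne_top ENNReal.coe_ne_top,
      ENNReal.mul_ne_top (by simp) huT⟩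
  have hae : ∀ᵐ y ∂lam, (γ₀ * v y + 2 * u y : ℝ≥0∞) < γ₀ * v₁ + 2 * u p.2 :=
    (ae_uniformBall_mem x r).mono fun y hy => hlt y (hrO hy)
  have hstrict : ∫⁻ y, (γ₀ * v y + 2 * u y : ℝ≥0∞) ∂lam < ∫⁻ _, (γ₀ * v₁ + 2 * u p.2) ∂lam := by
    refine lintegral_strict_mono (IsProbabilityMeasure.ne_zero lam) measurable_const.aemeasurable
      (ne_top_of_le_ne_top (b := ∫⁻ _, (γ₀ * v₁ + 2 * u p.2) ∂lam) ?_
        (lintegral_mono_ae (hae.mono fun y hy => hy.le))) hae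
    simpa using hM
  rw [lintegral_const, measure_univ, mul_one] at hstrict
  have hle' : (γ₀ * v₁ + 2 * u p.2 : ℝ≥0∞) ≤ ∫⁻ y, (γ₀ * v y + 2 * u y : ℝ≥0∞) ∂lam := by
    simpa using hle
  exact hle'.not_gt hstrict

end Abstract

/-! ### Ordering of charges by levels of the confining potential -/

namespace Reduction

variable {d : ℕ} {c ε m : ℝ} {V : Space d → ℝ} {W : Space d → Space d → EReal}
  {qmin qmax : ℝ} {ν : Measure ℝ} {g : ℝ → ℝ} {G : ℝ → ℝ≥0} {μ : Measure (ℝ × Space d)}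
  [IsProbabilityMeasure ν] (R : Reduction qmin qmax ν g V W c ε m G)
include R

/-- Particles with stronger confinement sit at lower levels of the confining potential, strictly so
where forces are defined. -/
theorem level_le (hd : d ≠ 0) (hμ : μ ∈ withCharge d ν)
    (h : IsReducedMin G (reducedPotential m V) (reducedKernel c ε V W) μ)
    {p p' : ℝ × Space d} (hp : p ∈ μ.support) (hp' : p' ∈ μ.support) {lo hi : ℝ≥0} (hlt : lo < hi)
    (hlo : ∀ᶠ q in 𝓝 p.1, G q ≤ lo) (hhi : ∀ᶠ q in 𝓝 p'.1, hi ≤ G q) :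
    V p'.2 ≤ V p.2 ∧ (HasForces V W μ p.2 → HasForces V W μ p'.2 → V p'.2 < V p.2) := by
  have hprob := hμ.1
  have hfin := R.reducedEnergy_ne_top hd hμ h
  have hVc := R.confining.cont
  have hv := continuous_reducedPotential (m := m) hVc
  have hk := (continuous_reducedKernel (c := c) (ε := ε) hVc R.interaction).measurable
  have hpos : ∀ᵐ p ∂μ, 0 < p.1 := (R.charge_mem hμ.2).mono fun p hp => R.pos.trans_le hp.1
  have hmass : chargeDensity μ Set.univ ≠ ⊤ := by
    rw [R.chargeDensity_univ hμ.2]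
    exact ENNReal.ofReal_ne_top
  have hvV : ∀ x, (reducedPotential m V x : ℝ) = V x - m := fun x =>
    Real.coe_toNNReal _ (sub_nonneg.2 (R.le_conf x))
  have hle : V p'.2 ≤ V p.2 := by
    by_contra! hV
    have hv' : reducedPotential m V p.2 < reducedPotential m V p'.2 := by
      rw [← NNReal.coe_lt_coe, hvV, hvV]
      linarith
    -- An intermediate level separates neighbourhoods of the two points, while `lo < hi` separates
    -- the strengths, as `IsReducedMin.not_ordered` demands.
    obtain ⟨vA, h1, h2⟩ := exists_between hv'
    have hG := R.measurable
    refine h.not_ordered (A := {z : ℝ × Space d | G z.1 ≤ lo ∧ reducedPotential m V z.2 ≤ vA})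
      (B := {z : ℝ × Space d | hi ≤ G z.1 ∧ vA < reducedPotential m V z.2}) (gA := lo) (vA := vA)
      R.measurable hv.measurable hfin hpos hmass ?_ ?_ ?_ ?_ (fun z hz => hz.1) (fun z hz => hz.2)
      (fun z hz => hlt.trans_le hz.1) (fun z hz => hz.2)
    · exact (measurableSet_le (hG.comp measurable_fst) measurable_const).inter
        (measurableSet_le (by fun_prop) measurable_const)
    · exact (measurableSet_le measurable_const (hG.comp measurable_fst)).inter
        (measurableSet_lt measurable_const (by fun_prop))
    · refine ((Measure.mem_support_iff_forall p).1 hp _ ?_).ne'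
      rw [show 𝓝 p = 𝓝 p.1 ×ˢ 𝓝 p.2 from nhds_prod_eq]
      exact (hlo.prod_inl _).and (((hv.continuousAt.eventually_lt_const h1).mono
        fun y hy => hy.le).prod_inr _)
    · refine ((Measure.mem_support_iff_forall p').1 hp' _ ?_).ne'
      rw [show 𝓝 p' = 𝓝 p'.1 ×ˢ 𝓝 p'.2 from nhds_prod_eq]
      exact (hhi.prod_inl _).and ((hv.continuousAt.eventually_const_lt h2).prod_inr _)
  refine ⟨hle, fun hx hx' => lt_of_le_of_ne hle fun hVeq => ?_⟩
  obtain ⟨δ, M, hδ, hb⟩ := R.bounds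
  set u : Space d → ℝ≥0∞ := fun y => ∫⁻ x', reducedKernel c ε V W y x' ∂chargeDensity μ
  set v := reducedPotential m V
  have hveq : v p'.2 = v p.2 := by rw [← NNReal.coe_inj, hvV, hvV, hVeq]
  have hpot : ∀ {x}, HasForces V W μ x → ContinuousAt u x ∧ u x ≠ ⊤ := by
    intro x hx
    obtain ⟨w, hwd, hw⟩ := R.exists_potential_eq_ofReal hμ hfin hx
    refine ⟨?_, ?_⟩
    · refine ContinuousAt.congr (f := fun y => ENNReal.ofReal (w y)) ?_
        (hw.mono fun y hy => hy.2.symm)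
      exact ENNReal.continuous_ofReal.continuousAt.comp hwd.continuousAt
    · change ∫⁻ x', reducedKernel c ε V W x x' ∂chargeDensity μ ≠ ⊤
      rw [hw.self_of_nhds.2]
      exact ENNReal.ofReal_ne_top
  have hball := fun (x : Space d) (r : ℝ) (hr : 0 < r) =>
    mutualEnergy_uniformBall_ne_top (c := c) (ε := ε) hd hVc R.interaction x hr
  -- The effective strengths at `p` and `p'` lie in `Icc 0 lo` and `Icc hi M`, hence differ.
  obtain ⟨γ, hγ, hγO⟩ := h.exists_effective_strength R.measurable hv hk
    (reducedKernel_comm R.interaction) hball hfin hpos hmass hp (lo := 0)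
    (hlo.mono fun q hq => ⟨zero_le, hq⟩) (hpot hx).1 (hpot hx).2
  obtain ⟨γ', hγ', hγO'⟩ := h.exists_effective_strength R.measurable hv hk
    (reducedKernel_comm R.interaction) hball hfin hpos hmass hp' (hi := M)
    (hhi.mono fun q hq => ⟨hq, (hb q).2⟩) (hpot hx').1 (hpot hx').2
  have hcont : ∀ (s : ℝ≥0) {x}, HasForces V W μ x →
      ContinuousAt (fun y => (s * v y + 2 * u y : ℝ≥0∞)) x := by
    intro s x hx
    refine ContinuousAt.add ?_ (ENNReal.Tendsto.const_mul (hpot hx).1 (Or.inr (by simp)))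
    have : Continuous fun y => ((s * v y : ℝ≥0) : ℝ≥0∞) :=
      ENNReal.continuous_coe.comp (by fun_prop)
    simpa using this.continuousAt
  have hcancel : ∀ (s : ℝ≥0) {y z}, v y = v z →
      (s * v y + 2 * u y : ℝ≥0∞) ≤ s * v z + 2 * u z → u y ≤ u z := by
    intro s y z hyz hle
    rw [hyz, ENNReal.add_le_add_iff_left (ENNReal.mul_ne_top ENNReal.coe_ne_top ENNReal.coe_ne_top),
      ENNReal.mul_le_mul_iff_right (by simp) (by simp)] at hle
    exact hle
  -- Continuity at the other point turns the inequality on open sets into one at that point, where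
  -- the equal confinement terms cancel.
  have hu1 : u p.2 ≤ u p'.2 := hcancel γ hveq.symm
    (le_of_dense_of_continuousAt (φ := fun y => (γ * v y + 2 * u y : ℝ≥0∞)) (hcont γ hx') hγO)
  have hu2 : u p'.2 ≤ u p.2 := hcancel γ' hveq
    (le_of_dense_of_continuousAt (φ := fun y => (γ' * v y + 2 * u y : ℝ≥0∞)) (hcont γ' hx) hγO')
  have hueq : u p.2 = u p'.2 := le_antisymm hu1 hu2
  have hγO : ∀ O : Set (Space d), IsOpen O → O.Nonempty → ∃ y ∈ O,
      (γ * v p'.2 + 2 * u p'.2 : ℝ≥0∞) ≤ γ * v y + 2 * u y := by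
    rw [hveq, ← hueq]
    exact hγO
  obtain ⟨w, hwd, hw⟩ := R.exists_potential_eq_ofReal hμ hfin hx'
  have hstat : ∀ s : ℝ≥0, (∀ O : Set (Space d), IsOpen O → O.Nonempty → ∃ y ∈ O,
      (s * v p'.2 + 2 * u p'.2 : ℝ≥0∞) ≤ s * v y + 2 * u y) →
      (s : ℝ) • fderiv ℝ V p'.2 + (2 : ℝ) • fderiv ℝ w p'.2 = 0 := by
    intro s hs
    have hder : HasFDerivAt (fun y => (s : ℝ) * (V y - m) + 2 * w y)
        ((s : ℝ) • fderiv ℝ V p'.2 + (2 : ℝ) • fderiv ℝ w p'.2) p'.2 :=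
      ((hx'.diff_conf.hasFDerivAt.sub_const m).const_mul (s : ℝ)).add
        (hwd.hasFDerivAt.const_mul (2 : ℝ))
    have hreal : ∀ y, 0 ≤ w y → u y = ENNReal.ofReal (w y) →
        (s * v y + 2 * u y : ℝ≥0∞) = ENNReal.ofReal ((s : ℝ) * (V y - m) + 2 * w y) := by
      intro y hwy huy
      rw [huy, ← hvV, ENNReal.ofReal_add (by positivity) (by positivity),
        ENNReal.ofReal_mul (by positivity), ENNReal.ofReal_mul (by positivity),
        ENNReal.ofReal_coe_nnreal, ENNReal.ofReal_coe_nnreal, ENNReal.ofReal_ofNat]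
    refine hasFDerivAt_eq_zero_of_dense hder (eventually_smallSets.2 ⟨_, hw, ?_⟩)
    intro U hU O hOU hO hO0
    obtain ⟨y, hy, hle⟩ := hs O hO hO0
    have hwy := hU (hOU hy)
    refine ⟨y, hy, ?_⟩
    rw [hreal _ hw.self_of_nhds.1 hw.self_of_nhds.2, hreal y hwy.1 hwy.2] at hle
    refine (ENNReal.ofReal_le_ofReal_iff ?_).1 hle
    have h1 := hwy.1
    have h2 := sub_nonneg.2 (R.le_conf y)
    positivity
  have e1 := hstat γ hγO
  have e2 := hstat γ' hγO'
  -- Subtracting the two stationarity equations eliminates the gradient of the charge potential.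
  have e3 : ((γ' : ℝ) - γ) • fderiv ℝ V p'.2 = 0 := by
    rw [sub_smul, sub_eq_zero]
    exact add_right_cancel (e2.trans e1.symm)
  rcases smul_eq_zero.1 e3 with h0 | h0
  · have h1 : γ < γ' := (hγ.2.trans_lt hlt).trans_le hγ'.1
    rw [← NNReal.coe_lt_coe] at h1
    linarith
  · exact hx'.grad_ne_zero h0

end Reduction

end

/-! ### Existence of an equilibrium for constant strength -/

section

section Semicontinuity

/-- Integrals of nonnegative continuous functions are lower semicontinuous for weak convergence. -/
lemma lowerSemicontinuous_lintegral {X : Type*} [TopologicalSpace X] [MeasurableSpace X]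
    [OpensMeasurableSpace X] {f : X → ℝ≥0∞} (hf : Continuous f) :
    LowerSemicontinuous fun ρ : ProbabilityMeasure X => ∫⁻ x, f x ∂(ρ : Measure X) := by
  -- The integral is a supremum of integrals of the bounded continuous truncations `min f n`, each
  -- continuous for weak convergence.
  have hsup : ∀ x, f x = ⨆ n : ℕ, min (f x) n := fun x => by
    rw [← inf_iSup_eq, ENNReal.iSup_natCast, inf_top_eq]
  have hcont : ∀ n : ℕ, Continuous fun x => (min (f x) n).toNNReal := fun n =>
    ENNReal.continuousOn_toNNReal.comp_continuous (hf.min continuous_const) fun x =>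
      ne_top_of_le_ne_top (ENNReal.natCast_ne_top n) (min_le_right _ _)
  have heq : (fun ρ : ProbabilityMeasure X => ∫⁻ x, f x ∂(ρ : Measure X)) =
      fun ρ : ProbabilityMeasure X => ⨆ n : ℕ, ∫⁻ x, (min (f x) n).toNNReal ∂(ρ : Measure X) := by
    ext ρ
    have h1 : ∀ (n : ℕ) x, ((min (f x) n).toNNReal : ℝ≥0∞) = min (f x) n := fun n x =>
      ENNReal.coe_toNNReal (ne_top_of_le_ne_top (ENNReal.natCast_ne_top n) (min_le_right _ _))
    simp_rw [h1]
    rw [← lintegral_iSup (fun n => (hf.min continuous_const).measurable) fun i j hij x =>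
      min_le_min le_rfl (Nat.cast_le.2 hij)]
    exact lintegral_congr fun x => hsup x
  rw [heq]
  refine lowerSemicontinuous_iSup fun n => Continuous.lowerSemicontinuous ?_
  have hbound : ∀ x, (min (f x) n).toNNReal ≤ n := fun x =>
    ENNReal.toNNReal_mono (ENNReal.natCast_ne_top n) (min_le_right _ _)
  exact ProbabilityMeasure.continuous_lintegral_boundedContinuousFunction
    (BoundedContinuousFunction.mkOfBound ⟨_, hcont n⟩ n fun x y => by
      rw [NNReal.dist_eq, abs_le]
      have h1 := NNReal.coe_le_coe.2 (hbound x)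
      have h2 := NNReal.coe_le_coe.2 (hbound y)
      have h3 := NNReal.coe_nonneg (min (f x) n).toNNReal
      have h4 := NNReal.coe_nonneg (min (f y) n).toNNReal
      simp only [NNReal.coe_natCast] at h1 h2
      constructor <;> simp only [ContinuousMap.coe_mk] <;> linarith)

end Semicontinuity

variable {d : ℕ} {c ε m : ℝ} {V : Space d → ℝ} {W : Space d → Space d → EReal}

/-- Energy of a charge distribution when the strength of the confinement is constant. -/
def densityEnergy (δ : ℝ≥0) (v : Space d → ℝ≥0) (k : Space d → Space d → ℝ≥0∞)
    (σ : Measure (Space d)) : ℝ≥0∞ :=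
  δ * ∫⁻ x, v x ∂σ + mutualEnergy k σ σ

/-- A constant strength comes out of the confinement integral, leaving $v$ integrated against the
charge density. Correlations between charge and position then have no cost of their own. -/
lemma reducedEnergy_const {δ : ℝ≥0} {v : Space d → ℝ≥0} (hv : Measurable v)
    {k : Space d → Space d → ℝ≥0∞} (μ : Measure (ℝ × Space d)) :
    reducedEnergy (fun _ => δ) v k μ = densityEnergy δ v k (chargeDensity μ) := by
  rw [reducedEnergy, densityEnergy, lintegral_chargeDensity _ (by fun_prop),
    ← lintegral_const_mul _ (by fun_prop), confinementEnergy]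
  congr 1
  refine lintegral_congr fun p => ?_
  ring

/-- Existence of a minimizing probability distribution, at total charge `a`. -/
theorem exists_min_densityEnergy {δ : ℝ≥0} (hδ : 0 < δ) {a : ℝ≥0} (ha : 0 < a) {v : Space d → ℝ≥0}
    (hv : Continuous v) (hvt : Tendsto v (cocompact (Space d)) atTop)
    {k : Space d → Space d → ℝ≥0∞} (hk : Continuous (Function.uncurry k))
    (hs : ∀ x y, k x y = k y x) (hfin : ∃ ρ : ProbabilityMeasure (Space d),
      densityEnergy δ v k ((a : ℝ≥0∞) • (ρ : Measure (Space d))) ≠ ⊤) :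
    ∃ ρ : ProbabilityMeasure (Space d), ∀ ρ' : ProbabilityMeasure (Space d),
      densityEnergy δ v k ((a : ℝ≥0∞) • (ρ : Measure (Space d))) ≤
        densityEnergy δ v k ((a : ℝ≥0∞) • (ρ' : Measure (Space d))) := by
  set J : ProbabilityMeasure (Space d) → ℝ≥0∞ :=
    fun ρ => densityEnergy δ v k ((a : ℝ≥0∞) • (ρ : Measure (Space d))) with hJ
  have hJeq : ∀ ρ, J ρ = (∫⁻ x, ((δ * a * v x : ℝ≥0) : ℝ≥0∞) ∂(ρ : Measure (Space d))) +
      ∫⁻ z, (a : ℝ≥0∞) ^ 2 * k z.1 z.2 ∂((ρ.prod ρ : ProbabilityMeasure (Space d × Space d)) :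
        Measure (Space d × Space d)) := by
    intro ρ
    have hkm : Measurable fun z : Space d × Space d => k z.1 z.2 := hk.measurable
    simp only [hJ, densityEnergy]
    rw [mutualEnergy_smul_left, mutualEnergy_smul_right hk.measurable hs, lintegral_smul_measure,
      lintegral_const_mul _ hkm, ProbabilityMeasure.toMeasure_prod,
      lintegral_prod _ hkm.aemeasurable, mutualEnergy]
    simp_rw [ENNReal.coe_mul]
    rw [lintegral_const_mul _ (by fun_prop)]
    simp only [smul_eq_mul]
    ring
  have hlsc : LowerSemicontinuous J := by
    have h1 : LowerSemicontinuous fun ρ : ProbabilityMeasure (Space d) =>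
        ∫⁻ x, ((δ * a * v x : ℝ≥0) : ℝ≥0∞) ∂(ρ : Measure (Space d)) :=
      lowerSemicontinuous_lintegral (ENNReal.continuous_coe.comp (by fun_prop))
    have h2 : LowerSemicontinuous fun ρ : ProbabilityMeasure (Space d × Space d) =>
        ∫⁻ z, (a : ℝ≥0∞) ^ 2 * k z.1 z.2 ∂(ρ : Measure (Space d × Space d)) :=
      lowerSemicontinuous_lintegral ((ENNReal.continuous_const_mul
        (ENNReal.pow_ne_top ENNReal.coe_ne_top)).comp hk)
    have h3 : Continuous fun ρ : ProbabilityMeasure (Space d) => ρ.prod ρ := by fun_prop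
    rw [show J = _ from funext hJeq]
    exact h1.add (LowerSemicontinuous.comp h2 h3)
  obtain ⟨ρ₀, hρ₀⟩ := hfin
  set S : Set (ProbabilityMeasure (Space d)) := {ρ | J ρ ≤ J ρ₀}
  have hSclosed : IsClosed S := hlsc.isClosed_preimage (J ρ₀)
  have htight : IsTightMeasureSet
      {((ρ : ProbabilityMeasure (Space d)) : Measure (Space d)) | ρ ∈ S} := by
    rw [isTightMeasureSet_iff_exists_isCompact_measure_compl_le]
    intro η hη
    have hda0 : (δ * a : ℝ≥0) ≠ 0 := (mul_pos hδ ha).ne'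
    set η' : ℝ≥0∞ := min η 1 with hη'
    have hη'0 : η' ≠ 0 := (lt_min hη one_pos).ne'
    have hη'T : η' ≠ ⊤ := ne_top_of_le_ne_top ENNReal.one_ne_top (min_le_right _ _)
    -- Markov's inequality: outside a compact set `v ≥ T`, and `T` is tuned so that energy at most
    -- `J ρ₀` leaves mass at most `η'` there. The `+ 1` keeps `T` nonzero; capping `η'` at one keeps
    -- it finite.
    set T : ℝ≥0∞ := (J ρ₀ + 1) / ((δ * a : ℝ≥0) * η') with hT
    have hTT : T ≠ ⊤ := ENNReal.div_ne_top
      (ENNReal.add_ne_top.2 ⟨hρ₀, ENNReal.one_ne_top⟩) (mul_ne_zero (by exact_mod_cast hda0) hη'0)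
    have hev : ∀ᶠ x in cocompact (Space d), T.toNNReal + 1 ≤ v x :=
      hvt.eventually_ge_atTop _
    obtain ⟨K, hK, hKv⟩ := mem_cocompact.1 hev
    refine ⟨K, hK, ?_⟩
    rintro _ ⟨ρ, hρ, rfl⟩
    refine le_trans ?_ (min_le_left η 1)
    have h1 : ∀ x ∈ Kᶜ, T ≤ v x := fun x hx => by
      rw [← ENNReal.coe_toNNReal hTT, ENNReal.coe_le_coe]
      exact le_trans le_self_add (hKv hx)
    have h2 : (δ * a : ℝ≥0) * (T * (ρ : Measure (Space d)) Kᶜ) ≤ J ρ₀ + 1 := by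
      refine le_trans ?_ ((hρ : J ρ ≤ J ρ₀).trans le_self_add)
      rw [hJeq]
      refine le_trans ?_ le_self_add
      simp_rw [ENNReal.coe_mul (δ * a)]
      rw [lintegral_const_mul _ (by fun_prop)]
      gcongr
      calc T * (ρ : Measure (Space d)) Kᶜ = ∫⁻ _ in Kᶜ, T ∂(ρ : Measure (Space d)) := by
            rw [setLIntegral_const]
        _ ≤ ∫⁻ x in Kᶜ, v x ∂(ρ : Measure (Space d)) :=
            setLIntegral_mono' hK.measurableSet.compl h1
        _ ≤ _ := setLIntegral_le_lintegral _ _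
    have hda0' : ((δ * a : ℝ≥0) : ℝ≥0∞) ≠ 0 := by exact_mod_cast hda0
    have hT' : (δ * a : ℝ≥0) * T * η' = J ρ₀ + 1 := by
      rw [mul_right_comm, hT]
      exact ENNReal.mul_div_cancel (mul_ne_zero hda0' hη'0)
        (ENNReal.mul_ne_top ENNReal.coe_ne_top hη'T)
    rw [← mul_assoc, ← hT'] at h2
    refine (ENNReal.mul_le_mul_iff_right ?_ (ENNReal.mul_ne_top ENNReal.coe_ne_top hTT)).1 h2
    intro h5
    rw [h5, zero_mul] at hT'
    exact (ne_of_gt (lt_of_lt_of_le one_pos le_add_self)) hT'.symm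
  have hScomp : IsCompact S := by
    have := isCompact_closure_of_isTightMeasureSet htight
    rwa [hSclosed.closure_eq] at this
  obtain ⟨ρ, hρS, hρ⟩ := (hlsc.lowerSemicontinuousOn S).exists_isMinOn
    (⟨ρ₀, (le_refl (J ρ₀) : J ρ₀ ≤ J ρ₀)⟩ : S.Nonempty) hScomp
  refine ⟨ρ, fun ρ' => ?_⟩
  by_cases h' : ρ' ∈ S
  · exact hρ h'
  · exact (hρS : J ρ ≤ J ρ₀).trans (not_le.1 (h' : ¬ J ρ' ≤ J ρ₀)).le

end

/-! ### Disordered and correlated minimizers for constant strength -/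

section

variable {d : ℕ} {c ε m : ℝ} {V : Space d → ℝ} {W : Space d → Space d → EReal}

/-- Perturbation of a product measure by a correlation between charge and position. -/
def correlated (ν : Measure ℝ) (ρ : Measure (Space d)) (f : ℝ → ℝ) (b : Space d → ℝ) (t : ℝ) :
    Measure (ℝ × Space d) :=
  (ν.prod ρ).withDensity fun p => ENNReal.ofReal (1 + t * f p.1 * b p.2)

section Correlated

variable {ν : Measure ℝ} {ρ : Measure (Space d)} [IsProbabilityMeasure ρ]
  {f : ℝ → ℝ} {b : Space d → ℝ} {t : ℝ}

/-- Integrating the density over positions leaves one, because `b` has mean zero under `ρ`. -/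
lemma map_fst_correlated (hf : Measurable f) (hb : Measurable b) (hbi : Integrable b ρ)
    (hb0 : ∫ x, b x ∂ρ = 0) (hnn : ∀ᵐ q ∂ν, ∀ x, 0 ≤ 1 + t * f q * b x) :
    (correlated ν ρ f b t).map Prod.fst = ν := by
  ext s hs
  rw [Measure.map_apply measurable_fst hs, correlated,
    withDensity_apply _ (measurable_fst hs), ← lintegral_indicator (measurable_fst hs),
    lintegral_prod _ (Measurable.aemeasurable
      (Measurable.indicator (by fun_prop) (measurable_fst hs)))]
  have : ∀ᵐ q ∂ν, ∫⁻ x, (Prod.fst ⁻¹' s : Set (ℝ × Space d)).indicator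
      (fun p => ENNReal.ofReal (1 + t * f p.1 * b p.2)) (q, x) ∂ρ = s.indicator 1 q := by
    filter_upwards [hnn] with q hq
    by_cases hqs : q ∈ s
    · have h1 : ∀ x, (Prod.fst ⁻¹' s : Set (ℝ × Space d)).indicator
          (fun p => ENNReal.ofReal (1 + t * f p.1 * b p.2)) (q, x) =
          ENNReal.ofReal (1 + t * f q * b x) := fun x => by
        rw [Set.indicator_of_mem (by exact hqs)]
      simp_rw [h1]
      have h2 : Integrable (fun x => 1 + t * f q * b x) ρ :=
        (integrable_const _).add (hbi.const_mul _)
      rw [Set.indicator_of_mem hqs, ← ofReal_integral_eq_lintegral_ofReal h2 (ae_of_all _ hq),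
        integral_add (integrable_const _) (hbi.const_mul _), integral_const_mul, hb0]
      simp
    · simp [hqs]
  rw [lintegral_congr_ae this, lintegral_indicator_one hs]

variable [IsProbabilityMeasure ν]

/-- At each position the charges average to $\int q(1+tf(q)b(x))\,d\nu=\int q\,d\nu$, because $\int
qf\,d\nu=0$. -/
lemma chargeDensity_correlated (hf : Measurable f) (hb : Measurable b)
    (hpos : ∀ᵐ q ∂ν, 0 ≤ q) (hq : Integrable (fun q : ℝ => q) ν)
    (hqf : Integrable (fun q => q * f q) ν) (hf0 : ∫ q, q * f q ∂ν = 0)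
    (hnn : ∀ᵐ q ∂ν, ∀ x, 0 ≤ 1 + t * f q * b x) :
    chargeDensity (correlated ν ρ f b t) = chargeDensity (ν.prod ρ) := by
  ext s hs
  have hsm : Measurable (s.indicator (1 : Space d → ℝ≥0∞)) := measurable_one.indicator hs
  rw [chargeDensity_prod, Measure.smul_apply, ← lintegral_indicator_one (μ := chargeDensity _) hs,
    lintegral_chargeDensity _ hsm, correlated,
    lintegral_withDensity_eq_lintegral_mul _ (by fun_prop) (by fun_prop),
    lintegral_prod_symm _ (by fun_prop), smul_eq_mul,
    ← ofReal_integral_eq_lintegral_ofReal hq hpos, ← lintegral_indicator_one hs,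
    ← lintegral_const_mul _ hsm]
  refine lintegral_congr fun x => ?_
  have h1 : ∀ᵐ q ∂ν, ((fun p : ℝ × Space d => ENNReal.ofReal (1 + t * f p.1 * b p.2)) *
      fun p : ℝ × Space d => ENNReal.ofReal p.1 * s.indicator (1 : Space d → ℝ≥0∞) p.2) (q, x) =
      ENNReal.ofReal (q + t * b x * (q * f q)) * s.indicator 1 x := by
    filter_upwards [hpos, hnn] with q h1 h2
    simp only [Pi.mul_apply]
    rw [← mul_assoc, ← ENNReal.ofReal_mul (h2 x)]
    congr 2
    ring
  have h2 : 0 ≤ᵐ[ν] fun q => q + t * b x * (q * f q) := by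
    filter_upwards [hpos, hnn] with q h1 h2
    have := mul_nonneg h1 (h2 x)
    simp only [Pi.zero_apply]
    linarith
  have h3 : Integrable (fun q => q + t * b x * (q * f q)) ν := hq.add (hqf.const_mul _)
  rw [lintegral_congr_ae h1, lintegral_mul_const _ (by fun_prop),
    ← ofReal_integral_eq_lintegral_ofReal h3 h2,
    integral_add hq (hqf.const_mul _), integral_const_mul, hf0, mul_zero, add_zero]

/-- Equal measures have almost everywhere equal densities, so $(t-s)f(q)b(x)=0$, and `b` never
vanishes. This yields injectivity in the parameter unless `f` is zero. -/
lemma ae_eq_zero_of_correlated_eq {s : ℝ} (hf : Measurable f) (hb : Measurable b)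
    (hb0 : ∀ x, b x ≠ 0) (hnn : ∀ᵐ q ∂ν, ∀ x, 0 ≤ 1 + t * f q * b x)
    (hnns : ∀ᵐ q ∂ν, ∀ x, 0 ≤ 1 + s * f q * b x) (hmap : (correlated ν ρ f b t).map Prod.fst = ν)
    (h : correlated ν ρ f b t = correlated ν ρ f b s) (hts : t ≠ s) : ∀ᵐ q ∂ν, f q = 0 := by
  have hfin : ∫⁻ p, ENNReal.ofReal (1 + t * f p.1 * b p.2) ∂ν.prod ρ ≠ ⊤ := by
    have h1 : (correlated ν ρ f b t).map Prod.fst Set.univ = 1 := by rw [hmap, measure_univ]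
    rw [Measure.map_apply measurable_fst MeasurableSet.univ, Set.preimage_univ, correlated,
      withDensity_apply _ MeasurableSet.univ, Measure.restrict_univ] at h1
    rw [h1]
    exact ENNReal.one_ne_top
  have h1 := (withDensity_eq_iff (by fun_prop) (by fun_prop) hfin).1 h
  have h2 : ∀ᵐ p ∂ν.prod ρ, f p.1 = 0 := by
    filter_upwards [h1, Measure.quasiMeasurePreserving_fst.ae hnn,
      Measure.quasiMeasurePreserving_fst.ae hnns] with p hp h3 h4
    rw [ENNReal.ofReal_eq_ofReal_iff (h3 _) (h4 _)] at hp
    have h5 : (t - s) * (f p.1 * b p.2) = 0 := by linarith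
    rcases mul_eq_zero.1 h5 with h6 | h6
    · exact absurd (sub_eq_zero.1 h6) hts
    · exact (mul_eq_zero.1 h6).resolve_right (hb0 _)
  have h3 : (ν.prod ρ).map Prod.fst = ν := by
    rw [Measure.map_fst_prod, measure_univ, one_smul]
  rw [← h3]
  exact (ae_map_iff measurable_fst.aemeasurable (measurableSet_eq_fun hf measurable_const)).2 h2

end Correlated

/-- A probability measure without atoms charges some set neither fully nor trivially. -/
lemma exists_measurableSet_measure_lt_one (ρ : Measure (Space d)) [IsProbabilityMeasure ρ]
    (h : ∀ x, ρ {x} = 0) : ∃ B, MeasurableSet B ∧ 0 < ρ B ∧ ρ B < 1 := by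
  obtain ⟨x, hx⟩ := Measure.nonempty_support (IsProbabilityMeasure.ne_zero ρ)
  -- Outer regularity at the null set `{x}` gives an open neighbourhood of mass below one; it has
  -- positive mass since `x` is in the support.
  obtain ⟨U, hxU, hU, hU1⟩ := Set.exists_isOpen_lt_of_lt {x} (1 : ℝ≥0∞) (by rw [h x]; exact one_pos)
  exact ⟨U, hU.measurableSet, (Measure.mem_support_iff_forall x).1 hx U
    (hU.mem_nhds (hxU rfl)), hU1⟩

namespace Reduction

variable {qmin qmax : ℝ} {ν : Measure ℝ} {g : ℝ → ℝ} {δ : ℝ≥0}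

lemma strength_pos (R : Reduction qmin qmax ν g V W c ε m fun _ => δ) : 0 < δ := by
  obtain ⟨δ', M, hδ', hb⟩ := R.bounds
  exact hδ'.trans_le (hb 0).1

variable [IsProbabilityMeasure ν] (R : Reduction qmin qmax ν g V W c ε m fun _ => δ)
include R

/-- Every competitor has total charge $\langle q\rangle$, and every $\langle q\rangle\rho$ is
realized by $\nu\otimes\rho$. The minimization thus depends on `ν` only through its mean, which
links it to the homogeneous gas. -/
lemma isEquilibrium_iff_density (hd : d ≠ 0) {μ : Measure (ℝ × Space d)} :
    IsEquilibrium g V W ν μ ↔ μ ∈ withCharge d ν ∧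
      ∀ ρ : Measure (Space d), IsProbabilityMeasure ρ →
        densityEnergy δ (reducedPotential m V) (reducedKernel c ε V W) (chargeDensity μ) ≤
        densityEnergy δ (reducedPotential m V) (reducedKernel c ε V W)
          (ENNReal.ofReal (meanCharge ν) • ρ) := by
  have hv := (continuous_reducedPotential (m := m) R.confining.cont).measurable
  have ha0 : ENNReal.ofReal (meanCharge ν) ≠ 0 := by simpa using R.meanCharge_pos
  rw [R.isEquilibrium_iff hd]
  refine and_congr_right fun hμ => ⟨fun h ρ hρ => ?_, fun h μ' hμ' => ?_⟩
  · have h1 := h (ν.prod ρ) (by rw [Measure.map_fst_prod, measure_univ, one_smul, hμ.2])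
    rwa [reducedEnergy_const hv, reducedEnergy_const hv, chargeDensity_prod,
      R.lintegral_charge] at h1
  · have h1 : chargeDensity μ' Set.univ = ENNReal.ofReal (meanCharge ν) :=
      R.chargeDensity_univ (hμ'.trans hμ.2)
    have h2 := h ((ENNReal.ofReal (meanCharge ν))⁻¹ • chargeDensity μ') ⟨by
      rw [Measure.smul_apply, h1, smul_eq_mul, ENNReal.inv_mul_cancel ha0 ENNReal.ofReal_ne_top]⟩
    rw [smul_smul, ENNReal.mul_inv_cancel ha0 ENNReal.ofReal_ne_top, one_smul] at h2
    rwa [reducedEnergy_const hv, reducedEnergy_const hv]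

/-- The homogeneous gas of mean charge satisfies the same hypotheses. -/
lemma homogeneous : Reduction qmin qmax (Measure.dirac (meanCharge ν)) g V W c ε m fun _ => δ where
  pos := R.pos
  charge := by
    exact (ae_dirac_iff (p := fun q => q ∈ Set.Icc qmin qmax) measurableSet_Icc).2
      R.meanCharge_mem
  confining := R.confining
  interaction := R.interaction
  eps_pos := R.eps_pos
  kernel_ge := R.kernel_ge
  le_conf := R.le_conf
  measurable := R.measurable
  bounds := R.bounds
  strength := by
    intro q hq
    rw [R.strength q hq, meanCharge, meanCharge, integral_dirac]

lemma isHomogeneousEquilibrium_iff (hd : d ≠ 0) {ρ : Measure (Space d)} :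
    IsHomogeneousEquilibrium g V W (meanCharge ν) ρ ↔ IsProbabilityMeasure ρ ∧
      ∀ ρ' : Measure (Space d), IsProbabilityMeasure ρ' →
        densityEnergy δ (reducedPotential m V) (reducedKernel c ε V W)
          (ENNReal.ofReal (meanCharge ν) • ρ) ≤
        densityEnergy δ (reducedPotential m V) (reducedKernel c ε V W)
          (ENNReal.ofReal (meanCharge ν) • ρ') := by
  refine and_congr_right fun hρ => ?_
  rw [R.homogeneous.isEquilibrium_iff_density hd, chargeDensity_prod, lintegral_dirac]
  have h1 : meanCharge (Measure.dirac (meanCharge ν)) = meanCharge ν := by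
    rw [meanCharge, integral_dirac]
  rw [h1]
  refine and_iff_right ⟨inferInstance, ?_⟩
  rw [Measure.map_fst_prod, measure_univ, one_smul]

lemma exists_isHomogeneousEquilibrium (hd : d ≠ 0) :
    ∃ ρ, IsHomogeneousEquilibrium g V W (meanCharge ν) ρ := by
  have hVc := R.confining.cont
  have hprob := isProbabilityMeasure_uniformBall (0 : Space d) one_pos
  have hv := continuous_reducedPotential (m := m) hVc
  have hk := continuous_reducedKernel (c := c) (ε := ε) hVc R.interaction
  obtain ⟨ρ, hρ⟩ := exists_min_densityEnergy R.strength_pos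
    (a := (meanCharge ν).toNNReal) (by simpa using R.meanCharge_pos) hv
    (tendsto_real_toNNReal_atTop.comp (tendsto_atTop_add_const_right _ (-m) R.confining.tendsto)) hk
    (reducedKernel_comm R.interaction) ⟨⟨uniformBall 0 1, hprob⟩, by
      rw [ProbabilityMeasure.coe_mk, densityEnergy, mutualEnergy_smul_left,
        mutualEnergy_smul_right hk.measurable (reducedKernel_comm R.interaction),
        lintegral_smul_measure]
      exact ENNReal.add_ne_top.2 ⟨ENNReal.mul_ne_top ENNReal.coe_ne_top
        (ENNReal.mul_ne_top ENNReal.coe_ne_top (lintegral_uniformBall_ne_top hv _ one_pos)),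
        ENNReal.mul_ne_top ENNReal.coe_ne_top (ENNReal.mul_ne_top ENNReal.coe_ne_top
          (mutualEnergy_uniformBall_ne_top hd hVc R.interaction _ one_pos))⟩⟩
  exact ⟨ρ, (R.isHomogeneousEquilibrium_iff hd).2
    ⟨inferInstance, fun ρ' hρ' => hρ ⟨ρ', hρ'⟩⟩⟩

lemma isEquilibrium_prod (hd : d ≠ 0) {ρ : Measure (Space d)}
    (h : IsHomogeneousEquilibrium g V W (meanCharge ν) ρ) :
    IsEquilibrium g V W ν (ν.prod ρ) := by
  obtain ⟨hρ, hmin⟩ := (R.isHomogeneousEquilibrium_iff hd).1 h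
  rw [R.isEquilibrium_iff_density hd, chargeDensity_prod, R.lintegral_charge]
  exact ⟨⟨inferInstance, by rw [Measure.map_fst_prod, measure_univ, one_smul]⟩, hmin⟩

theorem infinite_isEquilibrium (hd : d ≠ 0) (hν : ∀ a, ν ≠ Measure.dirac a) :
    {μ | IsEquilibrium g V W ν μ}.Infinite := by
  obtain ⟨ρ, hρ⟩ := R.exists_isHomogeneousEquilibrium hd
  have hprob := hρ.1
  have heq := R.isEquilibrium_prod hd hρ
  have hmem := (R.isEquilibrium_iff hd).1 heq
  have hfin := ne_top_of_le_ne_top (R.reducedEnergy_ne_top hd hmem.1 hmem.2) le_add_self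
  have ha := R.meanCharge_pos
  have hatom : ∀ x, ρ {x} = 0 := fun x => by
    have h1 := measure_singleton_eq_zero R.interaction hfin x
    rw [chargeDensity_prod, R.lintegral_charge, Measure.smul_apply, smul_eq_mul, mul_eq_zero] at h1
    exact h1.resolve_left (by simpa using ha)
  obtain ⟨B, hB, hB0, hB1⟩ := exists_measurableSet_measure_lt_one ρ hatom
  set β : ℝ := ρ.real B with hβ
  have hβ0 : 0 < β := ENNReal.toReal_pos hB0.ne' (measure_ne_top _ _)
  have hβ1 : β < 1 := by
    rw [hβ, Measure.real, ← ENNReal.toReal_one]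
    exact ENNReal.toReal_strict_mono ENNReal.one_ne_top hB1
  -- Centering the indicator gives mean zero, and `0 < β < 1` makes both values `1 - β` and `-β`
  -- nonzero.
  set b : Space d → ℝ := fun x => B.indicator 1 x - β with hb
  have hbm : Measurable b := (measurable_one.indicator hB).sub_const β
  have hb_or : ∀ x, b x = 1 - β ∨ b x = -β := fun x => by
    by_cases hx : x ∈ B <;> simp [hb, hx]
  have hb_ne : ∀ x, b x ≠ 0 := fun x => by
    rcases hb_or x with h | h <;> rw [h] <;> linarith
  have hb_abs : ∀ x, |b x| ≤ 1 := fun x => by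
    rw [abs_le]
    rcases hb_or x with h | h <;> rw [h] <;> constructor <;> linarith
  have hbi : Integrable b ρ := Integrable.of_bound hbm.aestronglyMeasurable 1 (ae_of_all _ hb_abs)
  have hb_int : ∫ x, b x ∂ρ = 0 := by
    have h1 : Integrable (B.indicator (1 : Space d → ℝ)) ρ := (integrable_const 1).indicator hB
    rw [hb, integral_sub h1 (integrable_const β), integral_indicator_one hB]
    simp [hβ]
  have hqi := R.integrable_charge
  have hq2 : Integrable (fun q : ℝ => q * q) ν :=
    hqi.bdd_mul (c := qmax) (by fun_prop) (R.charge.mono fun q hq => by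
      rw [Real.norm_eq_abs, abs_of_nonneg (R.pos.le.trans hq.1)]
      exact hq.2)
  -- The ratio of the second to the first moment, the only `r` with $\int q(q-r)\,d\nu=0$. It lies
  -- in `[0, qmax]`, so `|f| ≤ qmax` on the charges and `t < 1 / qmax` keeps the density
  -- nonnegative.
  set r : ℝ := (∫ q, q * q ∂ν) / meanCharge ν with hr
  set f : ℝ → ℝ := fun q => q - r with hf
  have hfm : Measurable f := by fun_prop
  have hqmax : 0 < qmax := ha.trans_le R.meanCharge_mem.2
  have hr0 : 0 ≤ r := div_nonneg (integral_nonneg fun q => mul_self_nonneg q) ha.le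
  have hr1 : r ≤ qmax := by
    rw [hr, div_le_iff₀ ha, meanCharge, ← integral_const_mul]
    exact integral_mono_ae hq2 (hqi.const_mul _) (R.charge.mono fun q hq =>
      mul_le_mul_of_nonneg_right hq.2 (R.pos.le.trans hq.1))
  have hf_abs : ∀ᵐ q ∂ν, |f q| ≤ qmax := R.charge.mono fun q hq => by
    have := R.pos
    rw [abs_le]
    constructor <;> simp only [hf] <;> linarith [hq.1, hq.2]
  have hqf : Integrable (fun q => q * f q) ν := by
    refine (hq2.sub (hqi.const_mul r)).congr (ae_of_all _ fun q => ?_)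
    simp only [hf, Pi.sub_apply]
    ring
  have hf_int : ∫ q, q * f q ∂ν = 0 := by
    have h1 : ∀ q, q * f q = q * q - r * q := fun q => by simp only [hf]; ring
    simp_rw [h1]
    rw [integral_sub hq2 (hqi.const_mul r), integral_const_mul, ← meanCharge, hr,
      div_mul_cancel₀ _ ha.ne', sub_self]
  have hnn : ∀ t ∈ Set.Ioo 0 (1 / qmax), ∀ᵐ q ∂ν, ∀ x, 0 ≤ 1 + t * f q * b x := by
    intro t ht
    filter_upwards [hf_abs] with q hq x
    have h1 : |t * f q * b x| ≤ 1 := by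
      rw [abs_mul, abs_mul, abs_of_pos ht.1]
      calc t * |f q| * |b x| ≤ 1 / qmax * qmax * 1 := by
            have := ht.2.le
            have := hb_abs x
            gcongr
        _ = 1 := by field_simp
    have := neg_abs_le (t * f q * b x)
    linarith
  have hmap : ∀ t ∈ Set.Ioo 0 (1 / qmax), (correlated ν ρ f b t).map Prod.fst = ν := fun t ht =>
    map_fst_correlated hfm hbm hbi hb_int (hnn t ht)
  refine Set.infinite_of_injOn_mapsTo (s := Set.Ioo (0 : ℝ) (1 / qmax))
    (f := correlated ν ρ f b) ?_ ?_ (Set.Ioo_infinite (by positivity))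
  · intro t ht s hs hts
    by_contra hne
    have h0 := ae_eq_zero_of_correlated_eq hfm hbm hb_ne (hnn t ht) (hnn s hs) (hmap t ht) hts hne
    -- Vanishing of `f` means that almost every charge equals `r`, so `ν` would be a Dirac mass.
    refine hν r ?_
    have h1 : (fun q : ℝ => q) =ᵐ[ν] fun _ => r := h0.mono fun q hq => sub_eq_zero.1 hq
    have h2 : ν.map (fun q : ℝ => q) = ν.map fun _ : ℝ => r := Measure.map_congr h1
    rwa [Measure.map_id', Measure.map_const, measure_univ, one_smul] at h2
  · intro t ht
    have hpos : ∀ᵐ q ∂ν, 0 ≤ q := R.charge.mono fun q hq => R.pos.le.trans hq.1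
    have h1 := (R.isEquilibrium_iff_density hd).1 heq
    refine (R.isEquilibrium_iff_density hd).2 ⟨⟨⟨?_⟩, hmap t ht⟩, ?_⟩
    · have h2 : (correlated ν ρ f b t).map Prod.fst Set.univ = 1 := by
        rw [hmap t ht, measure_univ]
      rwa [Measure.map_apply measurable_fst MeasurableSet.univ] at h2
    · rw [chargeDensity_correlated hfm hbm hpos hqi hqf hf_int (hnn t ht)]
      exact h1.2

end Reduction

/-! ### From levels of the potential to distances, and the ordering by charge -/

/-- Radial monotonicity says nothing directly about points of equal norm. For `y ≠ 0` the point `(1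
+ t) • y` is strictly farther out than `x`, and continuity lets `t` tend to zero. -/
lemma RadiallyIncreasing.le_of_norm_le (hr : RadiallyIncreasing V) (hV : Continuous V)
    {x y : Space d} (h : ‖x‖ ≤ ‖y‖) : V x ≤ V y := by
  rcases eq_or_ne y 0 with rfl | hy
  · rw [norm_zero, norm_le_zero_iff] at h
    rw [h]
  have hlim : Tendsto (fun t : ℝ => V ((1 + t) • y)) (𝓝[>] 0) (𝓝 (V y)) := by
    have h1 : Continuous fun t : ℝ => V ((1 + t) • y) := by fun_prop
    have h2 := h1.tendsto 0
    simp only [add_zero, one_smul] at h2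
    exact h2.mono_left nhdsWithin_le_nhds
  refine ge_of_tendsto hlim ?_
  filter_upwards [self_mem_nhdsWithin] with t ht
  have ht0 : (0 : ℝ) < t := ht
  refine (hr _ _ (h.trans_lt ?_)).le
  rw [norm_smul, Real.norm_of_nonneg (by positivity)]
  nlinarith [norm_pos_iff.2 hy]

lemma RadiallyIncreasing.norm_le (hr : RadiallyIncreasing V) {x y : Space d} (h : V x ≤ V y) :
    ‖x‖ ≤ ‖y‖ := not_lt.1 fun h' => (hr _ _ h').not_ge h

lemma RadiallyIncreasing.norm_lt (hr : RadiallyIncreasing V) (hV : Continuous V) {x y : Space d}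
    (h : V x < V y) : ‖x‖ < ‖y‖ := not_le.1 fun h' => (hr.le_of_norm_le hV h').not_gt h

lemma LargerChargesInside.norm {μ : Measure (ℝ × Space d)} (h : LargerChargesInside V W μ V)
    (hV : Continuous V) (hr : RadiallyIncreasing V) : LargerChargesInside V W μ fun x => ‖x‖ :=
  fun q x q' x' hx hx' hqq' => ⟨hr.norm_le (h q x q' x' hx hx' hqq').1,
    fun hf hf' => hr.norm_lt hV ((h q x q' x' hx hx' hqq').2 hf hf')⟩

lemma LargerChargesOutside.norm {μ : Measure (ℝ × Space d)} (h : LargerChargesOutside V W μ V)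
    (hV : Continuous V) (hr : RadiallyIncreasing V) : LargerChargesOutside V W μ fun x => ‖x‖ :=
  fun q x q' x' hx hx' hqq' => ⟨hr.norm_le (h q x q' x' hx hx' hqq').1,
    fun hf hf' => hr.norm_lt hV ((h q x q' x' hx hx' hqq').2 hf hf')⟩

namespace Reduction

variable {qmin qmax : ℝ} {ν : Measure ℝ} {g : ℝ → ℝ} {G : ℝ → ℝ≥0}

lemma charge_mem_of_mem_support (R : Reduction qmin qmax ν g V W c ε m G)
    {μ : Measure (ℝ × Space d)} (hμ : μ.map Prod.fst = ν) {p : ℝ × Space d} (hp : p ∈ μ.support) :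
    p.1 ∈ Set.Icc qmin qmax :=
  Measure.support_subset_of_isClosed (t := {p : ℝ × Space d | p.1 ∈ Set.Icc qmin qmax})
    (isClosed_Icc.preimage continuous_fst) (R.charge_mem hμ) hp

variable [IsProbabilityMeasure ν] (R : Reduction qmin qmax ν g V W c ε m G)
include R

lemma largerChargesInside (hd : d ≠ 0) (hG : Monotone G) (hG' : StrictMonoOn G (Set.Icc qmin qmax))
    {μ : Measure (ℝ × Space d)} (h : IsEquilibrium g V W ν μ) : LargerChargesInside V W μ V := by
  obtain ⟨hμ, hmin⟩ := (R.isEquilibrium_iff hd).1 h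
  intro q x q' x' hx hx' hqq'
  have hq : q ∈ Set.Icc qmin qmax := R.charge_mem_of_mem_support hμ.2 hx
  have hq' : q' ∈ Set.Icc qmin qmax := R.charge_mem_of_mem_support hμ.2 hx'
  -- Two intermediate charges `m₁ < m₂` bound `G` near `q` and near `q'` by distinct values, so no
  -- continuity of `g` is needed.
  obtain ⟨m₁, h1, h2⟩ := exists_between hqq'
  obtain ⟨m₂, h3, h4⟩ := exists_between h2
  exact R.level_le hd hμ hmin hx hx'
    (hG' ⟨hq.1.trans h1.le, h2.le.trans hq'.2⟩ ⟨(hq.1.trans h1.le).trans h3.le, h4.le.trans hq'.2⟩ h3)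
    ((eventually_le_nhds h1).mono fun s hs => hG hs)
    ((eventually_ge_nhds h4).mono fun s hs => hG hs)

lemma largerChargesOutside (hd : d ≠ 0) (hG : Antitone G)
    (hG' : StrictAntiOn G (Set.Icc qmin qmax))
    {μ : Measure (ℝ × Space d)} (h : IsEquilibrium g V W ν μ) : LargerChargesOutside V W μ V := by
  obtain ⟨hμ, hmin⟩ := (R.isEquilibrium_iff hd).1 h
  intro q x q' x' hx hx' hqq'
  have hq : q ∈ Set.Icc qmin qmax := R.charge_mem_of_mem_support hμ.2 hx
  have hq' : q' ∈ Set.Icc qmin qmax := R.charge_mem_of_mem_support hμ.2 hx'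
  obtain ⟨m₁, h1, h2⟩ := exists_between hqq'
  obtain ⟨m₂, h3, h4⟩ := exists_between h2
  -- Here the smaller charge is confined more strongly, so the two particles swap roles.
  have key := R.level_le hd hμ hmin hx' hx
    (hG' ⟨hq.1.trans h1.le, h2.le.trans hq'.2⟩ ⟨(hq.1.trans h1.le).trans h3.le, h4.le.trans hq'.2⟩ h3)
    ((eventually_ge_nhds h4).mono fun s hs => hG hs)
    ((eventually_le_nhds h1).mono fun s hs => hG hs)
  exact ⟨key.1, fun hf hf' => key.2 hf' hf⟩

end Reduction

end

end

end HeteroGas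

theorem mainTheorem8 {d : ℕ} (hd : 2 ≤ d) {qmin qmax : ℝ} (hq : 0 < qmin)
    (ν : Measure ℝ) [IsProbabilityMeasure ν] (hν : ν (Set.Icc qmin qmax)ᶜ = 0)
    (g : ℝ → ℝ) (hg : ∀ q ∈ Set.Icc qmin qmax, 0 < g q)
    (V : HeteroGas.Space d → ℝ) (hV : HeteroGas.IsConfining V)
    (W : HeteroGas.Space d → HeteroGas.Space d → EReal) (hW : HeteroGas.IsInteraction W)
    (hVW : HeteroGas.Dominates (Set.Icc qmin qmax) ν g V W) :
    (StrictMonoOn g (Set.Icc qmin qmax) →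
      ∀ μ, HeteroGas.IsEquilibrium g V W ν μ →
        HeteroGas.LargerChargesInside V W μ V ∧
        (HeteroGas.RadiallyIncreasing V →
          HeteroGas.LargerChargesInside V W μ (fun x => ‖x‖))) ∧
    (StrictAntiOn g (Set.Icc qmin qmax) →
      ∀ μ, HeteroGas.IsEquilibrium g V W ν μ →
        HeteroGas.LargerChargesOutside V W μ V ∧
        (HeteroGas.RadiallyIncreasing V →
          HeteroGas.LargerChargesOutside V W μ (fun x => ‖x‖))) ∧
    ((∃ γ, ∀ q ∈ Set.Icc qmin qmax, g q = γ) →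
      (∃ ρ, HeteroGas.IsHomogeneousEquilibrium g V W (HeteroGas.meanCharge ν) ρ) ∧
      (∀ ρ, HeteroGas.IsHomogeneousEquilibrium g V W (HeteroGas.meanCharge ν) ρ →
        HeteroGas.IsEquilibrium g V W ν (ν.prod ρ)) ∧
      ((∀ a, ν ≠ Measure.dirac a) →
        {μ | HeteroGas.IsEquilibrium g V W ν μ}.Infinite)) := by
  have hd0 : d ≠ 0 := by omega
  -- Otherwise the interval would be empty and could not carry a probability measure.
  have hle : qmin ≤ qmax := by
    by_contra! h
    rw [Set.Icc_eq_empty h.not_ge, Set.compl_empty, measure_univ] at hν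
    exact one_ne_zero hν
  have hmin : qmin ∈ Set.Icc qmin qmax := Set.left_mem_Icc.2 hle
  have hmax : qmax ∈ Set.Icc qmin qmax := Set.right_mem_Icc.2 hle
  refine ⟨fun hmono μ hμ => ?_, fun hanti μ hμ => ?_, fun ⟨γ, hγ⟩ => ?_⟩
  · have hG : Monotone fun q => g (Set.projIcc qmin qmax hle q) := fun a b hab =>
      hmono.monotoneOn (Subtype.coe_prop _) (Subtype.coe_prop _) (Set.monotone_projIcc hle hab)
    obtain ⟨c, ε, m, R⟩ := HeteroGas.exists_reduction hq hle hν hV hW hVW hG.measurable hmin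
      (q₂ := qmax) fun q hq => ⟨hmono.monotoneOn hmin hq hq.1, hmono.monotoneOn hq hmax hq.2⟩
    have h := R.largerChargesInside hd0
      (fun a b hab => Real.toNNReal_le_toNNReal (sub_le_sub_right (hG hab) _))
      (fun a ha b hb hab => by
        -- On the charge interval the truncation in `G` is inactive: restoring the share `2 * ε *
        -- meanCharge ν` gives back `g`, whose strict monotonicity applies.
        rw [← NNReal.coe_lt_coe, ← add_lt_add_iff_right (2 * ε * HeteroGas.meanCharge ν),
          ← R.strength a ha, ← R.strength b hb]
        exact hmono ha hb hab) hμ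
    exact ⟨h, fun hr => h.norm hV.cont hr⟩
  · have hG : Antitone fun q => g (Set.projIcc qmin qmax hle q) := fun a b hab =>
      hanti.antitoneOn (Subtype.coe_prop _) (Subtype.coe_prop _) (Set.monotone_projIcc hle hab)
    obtain ⟨c, ε, m, R⟩ := HeteroGas.exists_reduction hq hle hν hV hW hVW hG.measurable hmax
      (q₂ := qmin) fun q hq => ⟨hanti.antitoneOn hq hmax hq.2, hanti.antitoneOn hmin hq hq.1⟩
    have h := R.largerChargesOutside hd0
      (fun a b hab => Real.toNNReal_le_toNNReal (sub_le_sub_right (hG hab) _))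
      (fun a ha b hb hab => by
        rw [← NNReal.coe_lt_coe, ← add_lt_add_iff_right (2 * ε * HeteroGas.meanCharge ν),
          ← R.strength a ha, ← R.strength b hb]
        exact hanti ha hb hab) hμ
    exact ⟨h, fun hr => h.norm hV.cont hr⟩
  · have hG : ∀ q, g (Set.projIcc qmin qmax hle q) = γ := fun q => hγ _ (Subtype.coe_prop _)
    obtain ⟨c, ε, m, R⟩ := HeteroGas.exists_reduction hq hle hν hV hW hVW
      (by simp_rw [hG]; exact measurable_const) hmin (q₂ := qmin)
      fun q hq => ⟨(hγ _ hmin).trans_le (hγ _ hq).ge, (hγ _ hq).trans_le (hγ _ hmin).ge⟩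
    simp_rw [hG] at R
    exact ⟨R.exists_isHomogeneousEquilibrium hd0, fun ρ hρ => R.isEquilibrium_prod hd0 hρ,
      R.infinite_isEquilibrium hd0⟩
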